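/- Let $N\ge 2$ and let $(V,g)$ be an $N$-dimensional real vector space with a time-oriented Lorentzian inner product of signature $(+,-,\dots,-)$ (for instance a tangent space of a Lorentzian manifold). Indices are raised and lowered with $g$; a bold letter $\boldsymbol{k}$ denotes the 1-form $k_a=g_{ab}k^b$ of a vector $\vec k$. A null vector is a non-zero $\vec k$ with $g(\vec k,\vec k)=0$; an eigenvector of a symmetric tensor $S_{ab}$ is a $\vec v\ne 0$ with $S_{ab}v^b=\mu v_a$ for some $\mu\in\mathbb R$. A symmetric tensor $S_{ab}$ has the dominant property if $S_{ab}u^av^b\ge 0$ for all future-pointing causal vectors $\vec u,\vec v$. A $p$-form is simple if it is the exterior product of $p$ linearly independent 1-forms. For a rank-$n$ form $A$ put $$(A\odot A)_{ab}=\frac{(-1)^{n-1}}{(n-1)!}A_{ac_2\dots c_n}A_b{}^{c_2\dots c_n}.$$ The superenergy tensor of a $p$-form $\Omega$ is $T_{ab}\{\Omega\}=\frac12\big(\Omega\odot\Omega+{*\Omega}\odot{*\Omega}\big)_{ab}$ if $1\le p\le N-1$, with $*$ the Hodge dual, and $T_{ab}\{\Omega\}=\frac12f^2g_{ab}$ if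 $p=N$ and $\Omega=f\eta$ with $\eta$ the volume form. **Theorem.** Let $S_{ab}$ be a symmetric tensor with the dominant property, and let $\vec k_1,\dots,\vec k_d$ ($0\le d\le N$) be a maximal family of linearly independent null eigenvectors of $S_{ab}$. Then there are a basis $\vec n_1,\dots,\vec n_N$ of $V$ consisting of null vectors, with $\vec n_i=\vec k_i$ for $i\le d$, and $p$-forms $\Omega_{[p]}$, $p=1,\dots,N$, each of them zero (the term is absent) or simple, such that $$S_{ab}=\sum_{p=1}^N T_{ab}\{\Omega_{[p]}\},$$ and such that: 1. for every $p>1$, $\Omega_{[p]}$ is a (possibly zero) real multiple of $\boldsymbol n_1\wedge\dots\wedge\boldsymbol n_p$; 2. if $d\ge 1$, then $\Omega_{[p]}=0$ for all $p<d$, and $\Omega_{[d]}=c\,\boldsymbol k_1\wedge\dots\wedge\boldsymbol k_d$ with $c\in\mathbb R$, where $c\neq 0$ if $S_{ab}\ne 0$; 3. if $d=0$, then $\Omega_{[1]}=\boldsymbol u$ for a timelike eigenvector $\vec u$ of $S_{ab}$ (in particular $\Omega_{[1]}\neq0$). -/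

import Mathlib

/-!
For the largest `l` with `S(u, u) ≥ l g(u, u)` for all causal `u`, compactness gives a causal `u`
with equality. The 1-form `(S - l g)(u, ·)` is then nonnegative on the future cone and vanishes at
`u`, so it is a multiple of `g(u, ·)`, and `u` is an eigenvector. If some eigenvector is timelike,
then `S` is diagonal in a frame `f`, and the dominant property forces its eigenvalues to satisfy
`ρ 0 ≥ ρ 1 ≥ … ≥ ρ (N - 1) ≥ -ρ 0`. Otherwise the eigenvector is null, and `S` becomes diagonal,
with `ρ 1 = ρ 0`, after subtracting a positive multiple of the square of the null 1-form of
`f 0 + f 1`; this square is the superenergy tensor of that 1-form.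

The superenergy tensor of `f 0 ∧ … ∧ f (p - 1)` is diagonal as well: it is
`∑ i < p, sig i * θ_i ⊗ θ_i - g / 2`, where `θ_i` is the 1-form of `f i`. Hence a diagonal `S` is a
sum of such tensors with the coefficients `ρ (p - 1) - ρ p ≥ 0`, where `ρ N = -ρ 0`.

The null eigenvectors of a diagonal `S` lie in the eigenspace of `ρ 0`, which is spanned by
`f 0, …, f (m - 1)`. If `m ≥ 2`, they span it, so that `d = m`, and the coefficients with `p < d`
vanish; if `m = 1`, there are none. When `S` is not diagonalizable, `f 0 + f 1` is the only null
eigendirection. A null basis whose first `p` vectors span the same space as `f 0, …, f (p - 1)`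
gives exterior products proportional to those of the frame.
-/

noncomputable section

namespace Superenergy

variable {V : Type*} [AddCommGroup V] [Module ℝ V] {N : ℕ}

/-- The signature `+, -, …, -`. -/
def sig (i : Fin N) : ℝ := if i.val = 0 then 1 else -1

/-- `e` is an orthonormal basis of the `N`-dimensional Lorentzian vector space `(V, g)`. Its
existence says that `g` is a Lorentzian metric of signature `+, -, …, -`; the vector `e 0` fixes the
time orientation. -/
def IsFrame (g : LinearMap.BilinForm ℝ V) (e : Module.Basis (Fin N) ℝ V) : Prop :=
  ∀ i j, g (e i) (e j) = if i = j then sig i else 0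

/-- Timelike vectors. -/
def IsTimelike (g : LinearMap.BilinForm ℝ V) (u : V) : Prop := 0 < g u u

/-- Null vectors (non-zero by convention). -/
def IsNull (g : LinearMap.BilinForm ℝ V) (k : V) : Prop := k ≠ 0 ∧ g k k = 0

/-- Causal (timelike or null) vectors pointing to the same side as the timelike vector `t`. -/
def IsFutureCausal (g : LinearMap.BilinForm ℝ V) (t u : V) : Prop := 0 ≤ g u u ∧ 0 < g t u

/-- The dominant property of a rank-2 tensor, the future being the side of the timelike vector
`t`. -/
def Dominant (g : LinearMap.BilinForm ℝ V) (t : V) (S : LinearMap.BilinForm ℝ V) : Prop :=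
  ∀ u v, IsFutureCausal g t u → IsFutureCausal g t v → 0 ≤ S u v

/-- `v` is an eigenvector of the tensor `S` with respect to `g`: `S_{ab} v^b = μ v_a`. -/
def IsEigenvector (g S : LinearMap.BilinForm ℝ V) (v : V) : Prop :=
  v ≠ 0 ∧ ∃ μ : ℝ, ∀ w, S w v = μ * g w v

/-- `k` lists a maximal number of linearly independent null eigenvectors of `S`. -/
def IsMaxNullEigenfamily (g S : LinearMap.BilinForm ℝ V) {d : ℕ} (k : Fin d → V) : Prop :=
  LinearIndependent ℝ k ∧ (∀ i, IsNull g (k i) ∧ IsEigenvector g S (k i)) ∧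
    ∀ v, IsNull g v → IsEigenvector g S v → v ∈ Submodule.span ℝ (Set.range k)

/-- The exterior product `ω 0 ∧ … ∧ ω (p - 1)` of 1-forms; its value at `x` is
`det (ω i (x j))`. -/
def wedge {p : ℕ} (ω : Fin p → Module.Dual ℝ V) : V [⋀^Fin p]→ₗ[ℝ] ℝ :=
  (Matrix.detRowAlternating (n := Fin p) (R := ℝ)).compLinearMap (LinearMap.pi ω)

/-- A simple `p`-form: an exterior product of `p` linearly independent 1-forms. -/
def IsSimple {p : ℕ} (Ω : V [⋀^Fin p]→ₗ[ℝ] ℝ) : Prop :=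
  ∃ ω : Fin p → Module.Dual ℝ V, LinearIndependent ℝ ω ∧ Ω = wedge ω

/-- The exterior product of the 1-forms `(k i)_a = g_{ab} (k i)^b` metrically equivalent to the
vectors `k i`. -/
def wedgeVec (g : LinearMap.BilinForm ℝ V) {p : ℕ} (k : Fin p → V) : V [⋀^Fin p]→ₗ[ℝ] ℝ :=
  wedge fun i => g (k i)

/-- The vectors `e^i`, with `v_a w^a = ∑ i, v (e i) * w (e^i)`, used to raise indices. -/
def raised (e : Module.Basis (Fin N) ℝ V) (i : Fin N) : V := sig i • e i

/-- The product
`(A ⊙ A)_{ab} = (-1)^{n-1} / (n-1)! * A_{a c_2 … c_n} A_b^{c_2 … c_n}`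
of a rank-`n` covariant tensor `A` with itself, `n ≥ 1`. -/
def odot (e : Module.Basis (Fin N) ℝ V) : {n : ℕ} → ((Fin n → V) → ℝ) → V → V → ℝ
  | 0, _, _, _ => 0
  | n + 1, A, x, y => (-1) ^ n / (n.factorial : ℝ) *
      ∑ c : Fin n → Fin N, A (Fin.cons x fun j => e (c j)) * A (Fin.cons y fun j => raised e (c j))

/-- The Hodge dual
`(*Ω)_{a_{p+1} … a_N} = (1 / p!) η_{a_1 … a_N} Ω^{a_1 … a_p}`,
where the volume form `η` is the one with `η (e 0, …, e (N - 1)) = 1`. -/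
def hodge (e : Module.Basis (Fin N) ℝ V) {p : ℕ} (Ω : V [⋀^Fin p]→ₗ[ℝ] ℝ)
    (y : Fin (N - p) → V) : ℝ :=
  1 / (p.factorial : ℝ) * ∑ c : Fin p → Fin N,
    e.det (fun i : Fin N => if h : i.val < p then e (c ⟨i.val, h⟩) else y ⟨i.val - p, by omega⟩) *
      Ω fun j => raised e (c j)

/-- The superenergy tensor of a `p`-form, `1 ≤ p ≤ N`:
`T{Ω} = (1/2) (Ω ⊙ Ω + *Ω ⊙ *Ω)` for `p < N`, and `T{f η} = (1/2) f^2 g` for `p = N`. -/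
def superenergy (g : LinearMap.BilinForm ℝ V) (e : Module.Basis (Fin N) ℝ V) {p : ℕ}
    (Ω : V [⋀^Fin p]→ₗ[ℝ] ℝ) (x y : V) : ℝ :=
  if h : p = N then 1 / 2 * (Ω fun i => e (Fin.cast h i)) ^ 2 * g x y
  else 1 / 2 * (odot e (fun z => Ω z) x y + odot e (hodge e Ω) x y)

end Superenergy

end

namespace Superenergy

open Finset

/-! ### Superenergy tensors of exterior products -/

section SuperenergyOfProducts

variable {V : Type*} [AddCommGroup V] [Module ℝ V] {N : ℕ} {g : LinearMap.BilinForm ℝ V}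
  {e : Module.Basis (Fin N) ℝ V}

theorem sig_mul_self (i : Fin N) : sig i * sig i = 1 := by
  unfold sig; split_ifs <;> norm_num

theorem sig_zero {n : ℕ} : sig (0 : Fin (n + 1)) = 1 := rfl

theorem sig_of_ne_zero {n : ℕ} {i : Fin (n + 1)} (hi : i ≠ 0) : sig i = -1 :=
  if_neg (Fin.val_ne_zero_iff.2 hi)

theorem sig_succ {n : ℕ} (i : Fin n) : sig i.succ = -1 :=
  sig_of_ne_zero (Fin.succ_ne_zero i)

theorem prod_sig (n : ℕ) : ∏ i : Fin (n + 1), sig i = (-1) ^ n := by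
  simp [Fin.prod_univ_succ, sig_zero, sig_succ]

theorem IsFrame.apply_left (he : IsFrame g e) (i : Fin N) (x : V) :
    g (e i) x = sig i * e.repr x i := by
  conv_lhs => rw [← e.sum_repr x]
  simp only [map_sum, map_smul, he _ _, smul_eq_mul, mul_ite, mul_zero, sum_ite_eq, mem_univ,
    if_true]
  exact mul_comm _ _

theorem IsFrame.apply_right (he : IsFrame g e) (i : Fin N) (x : V) :
    g x (e i) = sig i * e.repr x i := by
  conv_lhs => rw [← e.sum_repr x]
  simp only [map_sum, map_smul, LinearMap.sum_apply, LinearMap.smul_apply, he _ _, smul_eq_mul,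
    mul_ite, mul_zero, sum_ite_eq', mem_univ, if_true]
  exact mul_comm _ _

theorem IsFrame.apply_raised (he : IsFrame g e) (i : Fin N) (x : V) :
    g x (raised e i) = e.repr x i := by
  rw [raised, map_smul, he.apply_right, smul_eq_mul, ← mul_assoc, sig_mul_self, one_mul]

theorem IsFrame.apply_eq_sum (he : IsFrame g e) (x y : V) :
    g x y = ∑ i, sig i * (g (e i) x * g (e i) y) := by
  conv_lhs => rw [← e.sum_repr x]
  simp only [map_sum, map_smul, LinearMap.sum_apply, LinearMap.smul_apply, smul_eq_mul]
  refine sum_congr rfl fun i _ => ?_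
  rw [he.apply_left i x, ← mul_assoc, ← mul_assoc, sig_mul_self, one_mul]

theorem IsFrame.isSymm (he : IsFrame g e) : g.IsSymm := by
  refine ⟨fun x y => ?_⟩
  rw [he.apply_eq_sum x y, he.apply_eq_sum y x]
  exact sum_congr rfl fun i _ => by rw [mul_comm (g _ x)]

theorem IsFrame.symm (he : IsFrame g e) (x y : V) : g x y = g y x :=
  he.isSymm.eq x y

theorem IsFrame.sum_apply_mul_apply_raised (he : IsFrame g e) (x y : V) :
    ∑ i, g x (e i) * g y (raised e i) = g x y := by
  conv_rhs => rw [← e.sum_repr y]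
  simp only [map_sum, map_smul, smul_eq_mul, he.apply_raised, mul_comm]

theorem IsFrame.sum_prod_apply_raised_mul (he : IsFrame g e) {p : ℕ}
    (A : MultilinearMap ℝ (fun _ : Fin p => V) ℝ) (v : Fin p → V) :
    ∑ c : Fin p → Fin N, (∏ j, g (v j) (raised e (c j))) * A (fun j => e (c j)) = A v := by
  conv_rhs => rw [show v = fun j => ∑ i, e.repr (v j) i • e i from
    funext fun j => (e.sum_repr (v j)).symm]
  rw [A.map_sum]
  exact sum_congr rfl fun c _ => by simp only [A.map_smul_univ, he.apply_raised, smul_eq_mul]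

/-- The Gram matrix `g (v i) (x j)` of two families of vectors, whose determinant is the value at
`x` of the exterior product of the `v i`. -/
noncomputable def gramMatrix (g : LinearMap.BilinForm ℝ V) {p : ℕ} (v x : Fin p → V) :
    Matrix (Fin p) (Fin p) ℝ :=
  Matrix.of fun i j => g (v i) (x j)

theorem wedgeVec_apply {p : ℕ} (v x : Fin p → V) :
    wedgeVec g v x = (gramMatrix g v x).det :=
  Matrix.det_transpose (gramMatrix g v x)

theorem wedgeVec_apply_comm (hg : g.IsSymm) {p : ℕ} (v x : Fin p → V) :
    wedgeVec g v x = wedgeVec g x v := by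
  rw [wedgeVec_apply, wedgeVec_apply, ← Matrix.det_transpose]
  exact congrArg Matrix.det (Matrix.ext fun i j => hg.eq (v j) (x i))

theorem wedgeVec_comp_equiv {p q : ℕ} (σ : Fin p ≃ Fin q) (v x : Fin q → V) :
    wedgeVec g (v ∘ σ) (x ∘ σ) = wedgeVec g v x := by
  simp only [wedgeVec_apply]
  exact Matrix.det_submatrix_equiv_self σ (gramMatrix g v x)

theorem wedgeVec_apply_cons {n : ℕ} (v : Fin (n + 1) → V) (x : V) (y : Fin n → V) :
    wedgeVec g v (Fin.cons x y) =
      ∑ i : Fin (n + 1), (-1) ^ (i : ℕ) * g (v i) x * wedgeVec g (v ∘ i.succAbove) y := by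
  simp only [wedgeVec_apply]
  exact Matrix.det_succ_column_zero _

theorem wedgeVec_cons_apply {n : ℕ} (x : V) (y : Fin n → V) (v : Fin (n + 1) → V) :
    wedgeVec g (Fin.cons x y : Fin (n + 1) → V) v =
      ∑ i : Fin (n + 1), (-1) ^ (i : ℕ) * g x (v i) * wedgeVec g y (v ∘ i.succAbove) := by
  simp only [wedgeVec_apply]
  exact Matrix.det_succ_row_zero _

theorem adjugate_gramMatrix_apply {n : ℕ} (v x : Fin (n + 1) → V) (i j : Fin (n + 1)) :
    (gramMatrix g v x).adjugate i j =
      (-1) ^ (j + i : ℕ) * wedgeVec g (v ∘ j.succAbove) (x ∘ i.succAbove) := by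
  rw [wedgeVec_apply]
  exact Matrix.adjugate_fin_succ_eq_det_submatrix _ i j

theorem wedgeVec_cons_apply_cons {p : ℕ} (a b : V) (v x : Fin p → V) :
    wedgeVec g (Fin.cons a v : Fin (p + 1) → V) (Fin.cons b x) =
      g a b * wedgeVec g v x -
        ∑ i, ∑ j, (gramMatrix g v x).adjugate i j * (g a (x i) * g (v j) b) := by
  cases p with
  | zero => simp [wedgeVec_apply, gramMatrix]
  | succ n =>
    rw [wedgeVec_cons_apply, Fin.sum_univ_succ, sub_eq_add_neg, ← sum_neg_distrib]
    congr 1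
    · simp [Function.comp_def]
    refine sum_congr rfl fun i _ => ?_
    have hcomp : (Fin.cons b x : Fin (n + 2) → V) ∘ i.succ.succAbove =
        Fin.cons b (x ∘ i.succAbove) := by
      funext j
      refine Fin.cases ?_ (fun j => ?_) j <;> simp
    rw [hcomp, wedgeVec_apply_cons, mul_sum, ← sum_neg_distrib]
    refine sum_congr rfl fun j _ => ?_
    rw [adjugate_gramMatrix_apply, Fin.cons_succ, Fin.val_succ]
    ring

theorem wedgeVec_snoc_apply_snoc {p : ℕ} (a b : V) (v x : Fin p → V) :
    wedgeVec g (Fin.snoc v a : Fin (p + 1) → V) (Fin.snoc x b) =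
      g a b * wedgeVec g v x -
        ∑ i, ∑ j, (gramMatrix g v x).adjugate i j * (g a (x i) * g (v j) b) := by
  rw [← wedgeVec_cons_apply_cons, ← wedgeVec_comp_equiv (finRotate (p + 1)) (Fin.cons a v),
    Fin.snoc_eq_cons_rotate, Fin.snoc_eq_cons_rotate]
  rfl

theorem IsFrame.sum_mul_wedgeVec_raised (he : IsFrame g e) {p : ℕ} (Ω : V [⋀^Fin p]→ₗ[ℝ] ℝ)
    (v : Fin p → V) :
    ∑ c : Fin p → Fin N, Ω (fun j => e (c j)) * wedgeVec g v (fun j => raised e (c j)) =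
      p.factorial * Ω v := by
  have hterm (σ : Equiv.Perm (Fin p)) :
      ∑ c : Fin p → Fin N, Ω (fun j => e (c j)) *
        ((Equiv.Perm.sign σ : ℝ) * ∏ j, g (v (σ j)) (raised e (c j))) = Ω v := by
    calc _ = (Equiv.Perm.sign σ : ℝ) * Ω (v ∘ σ) := by
          rw [← Ω.coe_multilinearMap, ← he.sum_prod_apply_raised_mul Ω.toMultilinearMap, mul_sum]
          exact sum_congr rfl fun c _ => mul_comm _ _ |>.trans (mul_assoc _ _ _)
      _ = Ω v := by
          rw [Ω.map_perm, Units.smul_def, zsmul_eq_mul, ← mul_assoc, ← Int.cast_mul,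
            Int.units_coe_mul_self, Int.cast_one, one_mul]
  simp only [wedgeVec_apply, Matrix.det_apply', gramMatrix, Matrix.of_apply, mul_sum]
  rw [sum_comm, sum_congr rfl fun σ _ => hterm σ]
  simp [Fintype.card_perm]

theorem IsFrame.sum_wedgeVec_snoc_mul (he : IsFrame g e) {p : ℕ} (v x : Fin p → V) :
    ∑ i, wedgeVec g (Fin.snoc v (e i) : Fin (p + 1) → V) (Fin.snoc x (raised e i)) =
      ((N : ℝ) - p) * wedgeVec g v x := by
  have htrace : ∑ i, ∑ j, (gramMatrix g v x).adjugate i j * g (v j) (x i) =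
      p * wedgeVec g v x := by
    rw [wedgeVec_apply]
    have := congrArg Matrix.trace (gramMatrix g v x).adjugate_mul
    simpa [Matrix.trace, Matrix.mul_apply, gramMatrix, mul_comm] using this
  have hcontract (i j : Fin p) : ∑ l, g (e l) (x i) * g (v j) (raised e l) = g (v j) (x i) := by
    rw [he.symm (v j), ← he.sum_apply_mul_apply_raised]
    exact sum_congr rfl fun l _ => by rw [he.symm (e l)]
  simp only [wedgeVec_snoc_apply_snoc, sum_sub_distrib, sub_mul, ← htrace, ← sum_mul, ← hcontract,
    mul_sum]
  congr 1
  · simp [he.apply_raised]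
  · rw [sum_comm]
    exact sum_congr rfl fun i _ => sum_comm

theorem IsFrame.sum_wedgeVec_append (he : IsFrame g e) {p : ℕ} (v x : Fin p → V) (q : ℕ) :
    ∑ c : Fin q → Fin N, wedgeVec g (Fin.append v fun j => e (c j))
        (Fin.append x fun j => raised e (c j)) =
      (∏ j ∈ range q, ((N : ℝ) - (p + j))) * wedgeVec g v x := by
  induction q with
  | zero => simp [Fin.append_right_nil _ _ rfl]
  | succ q ih =>
    rw [← (Fin.snocEquiv fun _ => Fin N).sum_comp, Fintype.sum_prod_type, sum_comm, prod_range_succ,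
      mul_right_comm, ← ih, sum_mul]
    refine sum_congr rfl fun c _ => ?_
    have hsnoc (u : Fin N → V) (i : Fin N) :
        (fun j => u (Fin.snocEquiv (fun _ => Fin N) (i, c) j)) =
          (Fin.snoc (fun j => u (c j)) (u i) : Fin (q + 1) → V) :=
      Fin.comp_snoc u c i
    simp only [hsnoc, Fin.append_snoc]
    rw [mul_comm, ← Nat.cast_add, ← he.sum_wedgeVec_snoc_mul]

theorem append_update_left {α : Type*} {p q : ℕ} (z : Fin p → α) (y : Fin q → α) (i : Fin p)
    (a : α) :
    Fin.append (Function.update z i a) y =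
      Function.update (Fin.append z y) (Fin.castAdd q i) a := by
  funext l
  refine Fin.addCases (fun l => ?_) (fun l => ?_) l
  · by_cases h : l = i
    · subst h; simp
    · simp [Function.update_of_ne, h]
  · rw [Function.update_of_ne]
    · simp
    · exact fun h => absurd (congrArg Fin.val h) (by simp; omega)

/-- The alternating form in the first `p` arguments obtained from an alternating form by fixing its
remaining arguments; it turns the Hodge dual into a contraction of two `p`-forms. -/
noncomputable def fixLast {p q : ℕ} (D : V [⋀^Fin (p + q)]→ₗ[ℝ] ℝ) (y : Fin q → V) :
    V [⋀^Fin p]→ₗ[ℝ] ℝ where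
  toFun z := D (Fin.append z y)
  map_update_add' {inst} z i a b := by
    rw [Subsingleton.elim inst (instDecidableEqFin p)]
    simp only [append_update_left, D.map_update_add]
  map_update_smul' {inst} z i a b := by
    rw [Subsingleton.elim inst (instDecidableEqFin p)]
    simp only [append_update_left, D.map_update_smul]
  map_eq_zero_of_eq' z i j h hij := by
    refine D.map_eq_zero_of_eq _ (i := Fin.castAdd q i) (j := Fin.castAdd q j) ?_ ?_
    · simpa using h
    · simpa using hij

theorem IsFrame.hodge_wedgeVec (he : IsFrame g e) {p : ℕ} (hp : p ≤ N) (v : Fin p → V)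
    (y : Fin (N - p) → V) :
    hodge e (wedgeVec g v) y = e.det (Fin.append v y ∘ Fin.cast (by omega)) := by
  have hcast : N = p + (N - p) := by omega
  have happend (z : Fin p → V) : (fun i : Fin N => if h : i.val < p then z ⟨i.val, h⟩ else
      y ⟨i.val - p, by omega⟩) = Fin.append z y ∘ Fin.cast hcast := by
    funext i
    obtain ⟨i, rfl⟩ := (finCongr hcast).symm.surjective i
    refine Fin.addCases (fun i => ?_) (fun i => ?_) i <;> simp
  have hcontract := he.sum_mul_wedgeVec_raised
    (fixLast (e.det.domDomCongr (finCongr hcast)) y) v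
  have hfact : (p.factorial : ℝ) ≠ 0 := by positivity
  simp only [hodge, fun c : Fin p → Fin N => happend fun j => e (c j)]
  exact (congrArg (1 / (p.factorial : ℝ) * ·) hcontract).trans
    (by rw [← mul_assoc, one_div_mul_cancel hfact, one_mul]; rfl)

theorem IsFrame.odot_wedgeVec (he : IsFrame g e) {n : ℕ} (v : Fin (n + 1) → V) (x y : V) :
    odot e (fun z => wedgeVec g v z) x y =
      (-1) ^ n * ∑ i, ∑ j, (gramMatrix g v v).adjugate i j * (g (v i) x * g (v j) y) := by
  have hcontract (j : Fin (n + 1)) : ∑ c : Fin n → Fin N,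
      wedgeVec g v (Fin.cons x fun l => e (c l)) *
        wedgeVec g (v ∘ j.succAbove) (fun l => raised e (c l)) =
      n.factorial * wedgeVec g v (Fin.cons x (v ∘ j.succAbove)) :=
    he.sum_mul_wedgeVec_raised ((wedgeVec g v).curryLeft x) _
  have hfact : (n.factorial : ℝ) ≠ 0 := by positivity
  calc odot e (fun z => wedgeVec g v z) x y
      = (-1) ^ n / n.factorial * ∑ j : Fin (n + 1), (-1) ^ (j : ℕ) * g (v j) y *
          (n.factorial * wedgeVec g v (Fin.cons x (v ∘ j.succAbove))) := by
        simp only [odot, wedgeVec_apply_cons v y, mul_sum, ← hcontract]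
        rw [sum_comm]
        exact sum_congr rfl fun j _ => sum_congr rfl fun c _ => by ring
    _ = (-1) ^ n * ∑ j : Fin (n + 1), (-1) ^ (j : ℕ) * g (v j) y *
          wedgeVec g v (Fin.cons x (v ∘ j.succAbove)) := by
        simp only [mul_sum]
        exact sum_congr rfl fun j _ => by field_simp
    _ = _ := by
        rw [sum_comm]
        congr 1
        refine sum_congr rfl fun j _ => ?_
        rw [wedgeVec_apply_cons, mul_sum]
        refine sum_congr rfl fun i _ => ?_
        rw [adjugate_gramMatrix_apply, wedgeVec_apply_comm he.isSymm]
        ring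

theorem IsFrame.wedgeVec_self (he : IsFrame g e) : wedgeVec g e e = ∏ i : Fin N, sig i := by
  rw [wedgeVec_apply, ← Matrix.det_diagonal]
  exact congrArg Matrix.det (Matrix.ext fun i j => by
    rw [gramMatrix, Matrix.of_apply, he i j, Matrix.diagonal_apply])

theorem IsFrame.wedgeVec_apply_eq_det_mul_det {n : ℕ} {e : Module.Basis (Fin (n + 1)) ℝ V}
    (he : IsFrame g e) (v x : Fin (n + 1) → V) :
    wedgeVec g v x = (-1) ^ n * (e.det v * e.det x) := by
  have happly (Ω : V [⋀^Fin (n + 1)]→ₗ[ℝ] ℝ) (z) : Ω z = Ω e * e.det z :=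
    congrArg (· z) (Ω.eq_smul_basis_det e)
  rw [happly (wedgeVec g v), wedgeVec_apply_comm he.isSymm, happly (wedgeVec g e),
    he.wedgeVec_self, prod_sig, mul_assoc]

theorem IsFrame.odot_det_append (he : IsFrame g e) {p q : ℕ} (hq : 0 < q) (hN : N = p + q)
    (v : Fin p → V) (x y : V) :
    odot e (fun z : Fin q → V => e.det (Fin.append v z ∘ Fin.cast hN)) x y =
      (-1) ^ p * wedgeVec g (Fin.snoc v x : Fin (p + 1) → V) (Fin.snoc v y) := by
  subst hN
  obtain ⟨m, rfl⟩ := Nat.exists_eq_add_one.2 hq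
  have hsnoc (a : V) (z : Fin m → V) : (Fin.append v (Fin.cons a z : Fin (m + 1) → V)) =
      Fin.append (Fin.snoc v a : Fin (p + 1) → V) z ∘ Fin.cast (by omega) :=
    Fin.append_right_cons v a z
  have hsign : (-1 : ℝ) ^ (p + m) * (-1) ^ (p + m) = 1 := by rw [← mul_pow]; norm_num
  have hfact : ∏ j ∈ range m, (((p + (m + 1) : ℕ) : ℝ) - ((p + 1 : ℕ) + j)) = m.factorial := by
    rw [← Nat.descFactorial_self, Nat.descFactorial_eq_prod_range, Nat.cast_prod]
    refine prod_congr rfl fun j hj => ?_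
    rw [Nat.cast_sub (mem_range.1 hj).le]
    push_cast
    ring
  have hdet (a b : Fin (p + (m + 1)) → V) : e.det a * e.det b =
      (-1) ^ (p + m) * wedgeVec g a b := by
    rw [he.wedgeVec_apply_eq_det_mul_det (n := p + m), ← mul_assoc, hsign, one_mul]
  have hcontract := he.sum_wedgeVec_append (Fin.snoc v x : Fin (p + 1) → V) (Fin.snoc v y) m
  have hcomp (a b : Fin (p + 1 + m) → V) :
      wedgeVec g (a ∘ Fin.cast (show p + (m + 1) = p + 1 + m by omega))
        (b ∘ Fin.cast (show p + (m + 1) = p + 1 + m by omega)) = wedgeVec g a b :=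
    wedgeVec_comp_equiv (finCongr (by omega)) a b
  simp only [odot, Fin.cast_refl, Function.comp_id, hdet, ← mul_sum, hsnoc, hcomp]
  rw [hcontract, hfact, pow_add]
  have hm : (-1 : ℝ) ^ m * (-1) ^ m = 1 := by rw [← mul_pow]; norm_num
  have hfact_ne : (m.factorial : ℝ) ≠ 0 := by positivity
  field_simp
  linear_combination wedgeVec g (Fin.snoc v x : Fin (p + 1) → V) (Fin.snoc v y) * hm

theorem IsFrame.superenergy_wedgeVec (he : IsFrame g e) {n : ℕ} (hn : n + 1 ≤ N)
    (v : Fin (n + 1) → V) (x y : V) :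
    superenergy g e (wedgeVec g v) x y = (-1) ^ n *
      (∑ i, ∑ j, (gramMatrix g v v).adjugate i j * (g (v i) x * g (v j) y) -
        1 / 2 * (gramMatrix g v v).det * g x y) := by
  have hsum : wedgeVec g (Fin.snoc v x : Fin (n + 2) → V) (Fin.snoc v y) =
      g x y * (gramMatrix g v v).det -
        ∑ i, ∑ j, (gramMatrix g v v).adjugate i j * (g (v i) x * g (v j) y) := by
    rw [wedgeVec_snoc_apply_snoc, wedgeVec_apply]
    simp only [he.symm x]
  rcases hn.lt_or_eq with hlt | rfl
  · rw [superenergy, dif_neg hlt.ne, he.odot_wedgeVec, funext (he.hodge_wedgeVec hn v),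
      he.odot_det_append (by omega), hsum]
    ring
  · have hvol : wedgeVec g v e ^ 2 = (-1) ^ n * (gramMatrix g v v).det := by
      rw [← wedgeVec_apply, he.wedgeVec_apply_eq_det_mul_det, he.wedgeVec_apply_eq_det_mul_det,
        e.det_self]
      ring
    have hzero : wedgeVec g (Fin.snoc v x : Fin (n + 2) → V) (Fin.snoc v y) = 0 := by
      refine AlternatingMap.map_linearDependent _ _ fun hli => ?_
      have := Module.Finite.of_basis e
      simpa [Module.finrank_eq_card_basis e] using hli.fintype_card_le_finrank
    rw [superenergy, dif_pos rfl]
    simp only [Fin.cast_refl, id]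
    rw [hvol]
    linear_combination (-1) ^ n * (hzero - hsum)

theorem IsFrame.superenergy_wedgeVec_frame (he : IsFrame g e) {f : Module.Basis (Fin N) ℝ V}
    (hf : IsFrame g f) {p : ℕ} (hp : 1 ≤ p) (hpN : p ≤ N) (x y : V) :
    superenergy g e (wedgeVec g fun i : Fin p => f (Fin.castLE hpN i)) x y =
      ∑ i : Fin p, sig (Fin.castLE hpN i) *
          (g (f (Fin.castLE hpN i)) x * g (f (Fin.castLE hpN i)) y) - 1 / 2 * g x y := by
  obtain ⟨n, rfl⟩ := Nat.exists_eq_add_one.2 hp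
  set v : Fin (n + 1) → V := fun i => f (Fin.castLE hpN i)
  have hsign : (-1 : ℝ) ^ n * (-1) ^ n = 1 := by rw [← mul_pow]; norm_num
  have hgram : gramMatrix g v v = Matrix.diagonal (sig : Fin (n + 1) → ℝ) := by
    ext i j
    rw [gramMatrix, Matrix.of_apply, hf, Matrix.diagonal_apply]
    exact if_congr (Fin.castLE_injective hpN).eq_iff rfl rfl
  have hdet : (gramMatrix g v v).det = (-1) ^ n := by
    rw [hgram, Matrix.det_diagonal, prod_sig]
  have hadj : (gramMatrix g v v).adjugate = (-1 : ℝ) ^ n • Matrix.diagonal sig := by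
    rw [hgram, Matrix.adjugate_diagonal, ← Matrix.diagonal_smul]
    refine congrArg Matrix.diagonal (funext fun i => ?_)
    rw [Pi.smul_apply, smul_eq_mul, ← prod_sig, ← mul_prod_erase univ sig (mem_univ i),
      mul_right_comm, sig_mul_self, one_mul]
  rw [he.superenergy_wedgeVec hpN, hdet, hadj, mul_sub]
  congr 1
  · simp only [Matrix.smul_apply, Matrix.diagonal_apply, smul_eq_mul, mul_ite, ite_mul, mul_zero,
      zero_mul, sum_ite_eq, mem_univ, if_true, mul_sum]
    refine sum_congr rfl fun i _ => ?_
    rw [mul_assoc, ← mul_assoc, hsign, one_mul]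
    rfl
  · rw [← mul_assoc, mul_left_comm, hsign, mul_one]

theorem IsFrame.superenergy_wedgeVec_null (he : IsFrame g e) (hN : 1 ≤ N) {u : V}
    (hu : g u u = 0) (x y : V) :
    superenergy g e (wedgeVec g fun _ : Fin 1 => u) x y = g u x * g u y := by
  rw [he.superenergy_wedgeVec hN]
  simp [gramMatrix, hu]

theorem odot_const_mul {n : ℕ} (a : ℝ) (A : (Fin n → V) → ℝ) (x y : V) :
    odot e (fun z => a * A z) x y = a ^ 2 * odot e A x y := by
  cases n with
  | zero => simp [odot]
  | succ n =>
    simp only [odot, mul_sum]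
    exact sum_congr rfl fun c _ => by ring

theorem hodge_smul {p : ℕ} (a : ℝ) (Ω : V [⋀^Fin p]→ₗ[ℝ] ℝ) :
    hodge e (a • Ω) = fun z => a * hodge e Ω z := by
  funext z
  simp only [hodge, mul_sum, AlternatingMap.smul_apply, smul_eq_mul]
  exact sum_congr rfl fun c _ => by ring

theorem superenergy_smul {p : ℕ} (a : ℝ) (Ω : V [⋀^Fin p]→ₗ[ℝ] ℝ) (x y : V) :
    superenergy g e (a • Ω) x y = a ^ 2 * superenergy g e Ω x y := by
  unfold superenergy
  split_ifs with h
  · simp only [AlternatingMap.smul_apply, smul_eq_mul]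
    ring
  · rw [hodge_smul, odot_const_mul]
    simp only [AlternatingMap.smul_apply, smul_eq_mul, odot_const_mul]
    ring

end SuperenergyOfProducts

/-! ### The causal cone and causal eigenvectors -/

section Cone

variable {V : Type*} [AddCommGroup V] [Module ℝ V] {n : ℕ} {g : LinearMap.BilinForm ℝ V}
  {e : Module.Basis (Fin (n + 1)) ℝ V}

theorem IsFrame.apply_zero_zero (he : IsFrame g e) : g (e 0) (e 0) = 1 := by
  rw [he, if_pos rfl, sig_zero]

theorem IsFrame.isFutureCausal_zero (he : IsFrame g e) : IsFutureCausal g (e 0) (e 0) := by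
  constructor <;> rw [he.apply_zero_zero]
  exacts [zero_le_one, zero_lt_one]

theorem IsFrame.apply_eq_sub (he : IsFrame g e) (x y : V) :
    g x y = g (e 0) x * g (e 0) y - ∑ j : Fin n, g (e j.succ) x * g (e j.succ) y := by
  rw [he.apply_eq_sum, Fin.sum_univ_succ]
  simp [sig_zero, sig_succ, sub_eq_add_neg]

theorem IsFrame.apply_self_eq_sub (he : IsFrame g e) (x : V) :
    g x x = g (e 0) x ^ 2 - ∑ j : Fin n, g (e j.succ) x ^ 2 := by
  simp only [he.apply_eq_sub x x, sq]

theorem IsFrame.abs_sum_le (he : IsFrame g e) {x y : V} (hx : 0 ≤ g x x) (hy : 0 ≤ g y y) :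
    |∑ j : Fin n, g (e j.succ) x * g (e j.succ) y| ≤ |g (e 0) x * g (e 0) y| := by
  rw [he.apply_self_eq_sub, sub_nonneg] at hx hy
  rw [← sq_le_sq, mul_pow]
  calc (∑ j : Fin n, g (e j.succ) x * g (e j.succ) y) ^ 2
      ≤ (∑ j : Fin n, g (e j.succ) x ^ 2) * ∑ j : Fin n, g (e j.succ) y ^ 2 :=
        sum_mul_sq_le_sq_mul_sq ..
    _ ≤ g (e 0) x ^ 2 * g (e 0) y ^ 2 :=
        mul_le_mul hx hy (sum_nonneg fun _ _ => sq_nonneg _) (sq_nonneg _)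

theorem IsFrame.eq_zero_of_apply_zero (he : IsFrame g e) {x : V} (hx : 0 ≤ g x x)
    (h0 : g (e 0) x = 0) : x = 0 := by
  have hsum : ∑ j : Fin n, g (e j.succ) x ^ 2 = 0 := by
    refine le_antisymm ?_ (sum_nonneg fun _ _ => sq_nonneg _)
    rw [he.apply_self_eq_sub, h0] at hx
    linarith
  rw [sum_eq_zero_iff_of_nonneg fun _ _ => sq_nonneg _] at hsum
  have hcoord : ∀ i, g (e i) x = 0 :=
    Fin.cases h0 fun j => pow_eq_zero_iff two_ne_zero |>.1 (hsum j (mem_univ j))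
  refine e.ext_elem fun i => ?_
  rw [← he.apply_raised, raised, map_smul, he.symm, hcoord]
  simp

theorem IsFrame.eq_zero_of_orthogonal (he : IsFrame g e) {u x : V} (hu : 0 < g u u)
    (hux : g u x = 0) (hx : 0 ≤ g x x) : x = 0 := by
  refine he.eq_zero_of_apply_zero hx ?_
  by_contra h0
  have hcs := sum_mul_sq_le_sq_mul_sq univ (fun j : Fin n => g (e j.succ) u)
    fun j => g (e j.succ) x
  rw [he.apply_eq_sub, sub_eq_zero] at hux
  rw [he.apply_self_eq_sub, sub_pos] at hu
  rw [he.apply_self_eq_sub, sub_nonneg] at hx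
  rw [← hux, mul_pow] at hcs
  refine absurd hcs (not_le.2 ?_)
  calc (∑ j : Fin n, g (e j.succ) u ^ 2) * ∑ j : Fin n, g (e j.succ) x ^ 2
      ≤ (∑ j : Fin n, g (e j.succ) u ^ 2) * g (e 0) x ^ 2 :=
        mul_le_mul_of_nonneg_left hx (sum_nonneg fun _ _ => sq_nonneg _)
    _ < g (e 0) u ^ 2 * g (e 0) x ^ 2 := mul_lt_mul_of_pos_right hu (by positivity)

theorem IsFrame.isFutureCausal_of_apply_pos (he : IsFrame g e) {u v : V}
    (hu : IsFutureCausal g (e 0) u) (hv : 0 ≤ g v v) (huv : 0 < g u v) :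
    IsFutureCausal g (e 0) v := by
  refine ⟨hv, ?_⟩
  by_contra! hneg
  have hcs := he.abs_sum_le hu.1 hv
  rw [abs_of_nonpos (mul_nonpos_of_nonneg_of_nonpos hu.2.le hneg)] at hcs
  rw [he.apply_eq_sub] at huv
  linarith [neg_le_of_abs_le hcs]

theorem IsFrame.apply_nonneg (he : IsFrame g e) {u v : V} (hu : IsFutureCausal g (e 0) u)
    (hv : IsFutureCausal g (e 0) v) : 0 ≤ g u v := by
  have hcs := he.abs_sum_le hu.1 hv.1
  rw [abs_of_nonneg (mul_nonneg hu.2.le hv.2.le)] at hcs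
  rw [he.apply_eq_sub, sub_nonneg]
  exact le_of_abs_le hcs

theorem IsFrame.isFutureCausal_add (he : IsFrame g e) {u v : V}
    (hu : IsFutureCausal g (e 0) u) (hv : IsFutureCausal g (e 0) v) :
    IsFutureCausal g (e 0) (u + v) := by
  constructor
  · simp only [map_add, LinearMap.add_apply, he.symm v u]
    linarith [hu.1, hv.1, he.apply_nonneg hu hv]
  · rw [map_add]
    exact add_pos hu.2 hv.2

theorem IsFutureCausal.smul {t u : V} (hu : IsFutureCausal g t u) {c : ℝ} (hc : 0 < c) :
    IsFutureCausal g t (c • u) := by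
  simp only [IsFutureCausal, map_smul, LinearMap.smul_apply, smul_eq_mul]
  exact ⟨mul_nonneg hc.le (mul_nonneg hc.le hu.1), mul_pos hc hu.2⟩

theorem nonneg_of_forall_nonneg_add_mul {C D : ℝ} (h : ∀ t, 0 < t → 0 ≤ C + t * D) : 0 ≤ D := by
  by_contra! hD
  have hmul : (|C| + 1) / -D * D = -(|C| + 1) := by
    rw [div_neg, neg_mul, div_mul_cancel₀ _ hD.ne]
  have := h ((|C| + 1) / -D) (div_pos (by positivity) (neg_pos.2 hD))
  linarith [le_abs_self C]

theorem exists_isFutureCausal_smul_add {t u x : V} (hg : g.IsSymm) (hu : IsFutureCausal g t u)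
    (hux : 0 < g u x) : ∃ A : ℝ, IsFutureCausal g t (A • u + x) := by
  have hcone := (Filter.tendsto_id.atTop_mul_const (r := 2 * g u x) (by positivity)
    ).eventually_ge_atTop (-g x x)
  have hfuture := (Filter.tendsto_id.atTop_mul_const hu.2).eventually_gt_atTop (-g t x)
  obtain ⟨A, hA, hA'⟩ := (hcone.and hfuture).exists
  rw [id] at hA hA'
  refine ⟨A, ?_, ?_⟩
  · simp only [map_add, map_smul, LinearMap.add_apply, LinearMap.smul_apply, smul_eq_mul,
      hg.eq x u]
    linarith [mul_nonneg (mul_self_nonneg A) hu.1]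
  · rw [map_add, map_smul, smul_eq_mul]
    linarith

theorem exists_eq_mul_of_nonneg_of_pos {φ q : Module.Dual ℝ V} {w : V} (hw : 0 < φ w)
    (hq : ∀ x, 0 < φ x → 0 ≤ q x) : ∃ c : ℝ, ∀ x, q x = c * φ x := by
  have hnonneg : ∀ x, φ x = 0 → 0 ≤ q x := fun x hx =>
    nonneg_of_forall_nonneg_add_mul (C := q w) fun t _ => by
      simpa [hx] using hq (w + t • x) (by simpa [hx] using hw)
  have hker : φ.ker ≤ q.ker := fun x hx => by
    have hx : φ x = 0 := hx
    have := hnonneg (-x) (by rw [map_neg, hx, neg_zero])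
    rw [map_neg] at this
    exact le_antisymm (by linarith) (hnonneg x hx)
  have hspan := mem_span_of_iInf_ker_le_ker (L := fun _ : Unit => φ) (K := q)
    ((iInf_le _ ()).trans hker)
  rw [Set.range_const, Submodule.mem_span_singleton] at hspan
  obtain ⟨c, rfl⟩ := hspan
  exact ⟨c, fun _ => rfl⟩

theorem IsFrame.exists_eq_mul_of_nonneg (he : IsFrame g e) {u : V}
    (hu : IsFutureCausal g (e 0) u) {q : Module.Dual ℝ V}
    (hq : ∀ v, IsFutureCausal g (e 0) v → 0 ≤ q v) (hqu : q u = 0) :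
    ∃ c : ℝ, ∀ x, q x = c * g u x := by
  refine exists_eq_mul_of_nonneg_of_pos (w := e 0) (he.symm u _ ▸ hu.2) fun x hx => ?_
  obtain ⟨A, hA⟩ := exists_isFutureCausal_smul_add he.isSymm hu hx
  simpa [hqu] using hq _ hA

theorem IsFrame.apply_zero_equivFun_symm (he : IsFrame g e) (z : Fin (n + 1) → ℝ) :
    g (e 0) (e.equivFun.symm z) = z 0 := by
  rw [he.apply_left, sig_zero, one_mul, ← e.equivFun_apply, LinearEquiv.apply_symm_apply]

theorem continuous_apply_equivFun_symm (B : LinearMap.BilinForm ℝ V) :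
    Continuous fun z : Fin (n + 1) → ℝ => B (e.equivFun.symm z) (e.equivFun.symm z) := by
  simp only [e.equivFun_symm_apply, map_sum, map_smul, LinearMap.sum_apply, LinearMap.smul_apply,
    smul_eq_mul]
  fun_prop

theorem IsFrame.isCompact_cone_section (he : IsFrame g e) :
    IsCompact {z : Fin (n + 1) → ℝ |
      z 0 = 1 ∧ 0 ≤ g (e.equivFun.symm z) (e.equivFun.symm z)} := by
  refine Metric.isCompact_of_isClosed_isBounded ?_ ?_
  · exact (isClosed_eq (continuous_apply 0) continuous_const).inter
      (isClosed_le continuous_const (continuous_apply_equivFun_symm g))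
  refine (Metric.isBounded_closedBall (x := 0) (r := 1)).subset fun z hz => ?_
  rw [mem_closedBall_zero_iff, pi_norm_le_iff_of_nonneg zero_le_one]
  have hnorm := hz.2
  rw [he.apply_self_eq_sub, he.apply_zero_equivFun_symm, hz.1, sub_nonneg] at hnorm
  refine Fin.cases (by rw [hz.1, norm_one]) fun j => ?_
  have hcoord : g (e j.succ) (e.equivFun.symm z) = -z j.succ := by
    rw [he.apply_left, sig_succ, neg_one_mul, ← e.equivFun_apply, LinearEquiv.apply_symm_apply]
  rw [Real.norm_eq_abs, ← sq_le_one_iff_abs_le_one, ← neg_sq, ← hcoord]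
  exact (single_le_sum (f := fun j : Fin n => g (e j.succ) (e.equivFun.symm z) ^ 2)
    (fun _ _ => sq_nonneg _) (mem_univ j)).trans (by simpa using hnorm)

theorem IsFrame.exists_pos_mul_sq_le (he : IsFrame g e) {Q : LinearMap.BilinForm ℝ V}
    (hQ : ∀ u, IsFutureCausal g (e 0) u → 0 < Q u u) :
    ∃ m > 0, ∀ u, IsFutureCausal g (e 0) u → m * g (e 0) u ^ 2 ≤ Q u u := by
  obtain ⟨z, hz, hmin⟩ := he.isCompact_cone_section.exists_isMinOn
    ⟨e.equivFun (e 0), by simp, by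
      rw [LinearEquiv.symm_apply_apply, he.apply_zero_zero]; exact zero_le_one⟩
    (continuous_apply_equivFun_symm (e := e) Q).continuousOn
  refine ⟨_, hQ _ ⟨hz.2, by rw [he.apply_zero_equivFun_symm, hz.1]; exact one_pos⟩, fun u hu => ?_⟩
  have hscaled : IsFutureCausal g (e 0) ((g (e 0) u)⁻¹ • u) := hu.smul (inv_pos.2 hu.2)
  have hle := hmin (a := e.equivFun ((g (e 0) u)⁻¹ • u)) ⟨?_, ?_⟩
  · simp only [Set.mem_ofPred_eq, LinearEquiv.symm_apply_apply, map_smul, LinearMap.smul_apply,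
      smul_eq_mul] at hle
    rwa [← mul_assoc, ← mul_inv, mul_comm (_ * _)⁻¹, ← div_eq_mul_inv,
      le_div_iff₀ (mul_pos hu.2 hu.2), ← sq] at hle
  · rw [← he.apply_zero_equivFun_symm (e.equivFun _), LinearEquiv.symm_apply_apply, map_smul,
      smul_eq_mul, inv_mul_cancel₀ hu.2.ne']
  · rw [LinearEquiv.symm_apply_apply]
    exact hscaled.1

theorem IsFrame.apply_self_le_sq (he : IsFrame g e) (x : V) : g x x ≤ g (e 0) x ^ 2 := by
  rw [he.apply_self_eq_sub]
  exact sub_le_self _ (sum_nonneg fun _ _ => sq_nonneg _)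

theorem IsFrame.exists_apply_self_eq_mul (he : IsFrame g e) {S : LinearMap.BilinForm ℝ V}
    (hS : ∀ u, IsFutureCausal g (e 0) u → 0 ≤ S u u) :
    ∃ l : ℝ, (∀ u, IsFutureCausal g (e 0) u → l * g u u ≤ S u u) ∧
      ∃ u, IsFutureCausal g (e 0) u ∧ S u u = l * g u u := by
  set L : Set ℝ := {l | ∀ u, IsFutureCausal g (e 0) u → l * g u u ≤ S u u}
  have zero_mem : (0 : ℝ) ∈ L := fun u hu => by simpa using hS u hu
  have bddAbove : BddAbove L := ⟨S (e 0) (e 0), fun l hl => by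
    simpa [he.apply_zero_zero] using hl (e 0) he.isFutureCausal_zero⟩
  have sSup_mem : sSup L ∈ L := fun u hu => by
    rcases hu.1.eq_or_lt with h | h
    · rw [← h, mul_zero]; exact hS u hu
    · rw [← le_div_iff₀ h]
      exact csSup_le ⟨0, zero_mem⟩ fun l hl => (le_div_iff₀ h).2 (hl u hu)
  refine ⟨sSup L, sSup_mem, ?_⟩
  by_contra! hne
  obtain ⟨m, hm, hmS⟩ := he.exists_pos_mul_sq_le (Q := S - sSup L • g) fun u hu => by
    simpa using lt_of_le_of_ne (sSup_mem u hu) (hne u hu).symm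
  have add_mem : sSup L + m ∈ L := fun u hu => by
    have hmu := hmS u hu
    simp only [LinearMap.sub_apply, LinearMap.smul_apply, smul_eq_mul] at hmu
    linarith [mul_le_mul_of_nonneg_left (he.apply_self_le_sq u) hm.le]
  linarith [le_csSup bddAbove add_mem]

theorem IsFrame.apply_nonneg_of_apply_self_eq_zero (he : IsFrame g e)
    {Q : LinearMap.BilinForm ℝ V} (hsymm : Q.IsSymm)
    (hQ : ∀ u, IsFutureCausal g (e 0) u → 0 ≤ Q u u) {u v : V} (hu : IsFutureCausal g (e 0) u)
    (hu0 : Q u u = 0) (hv : IsFutureCausal g (e 0) v) : 0 ≤ Q u v := by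
  refine nonneg_of_mul_nonneg_right (nonneg_of_forall_nonneg_add_mul (C := Q v v)
    (D := 2 * Q u v) fun t ht => ?_) two_pos
  have := hQ _ (he.isFutureCausal_add hv (hu.smul ht))
  simp only [map_add, map_smul, LinearMap.add_apply, LinearMap.smul_apply, smul_eq_mul, hu0,
    hsymm.eq v u] at this
  linarith

theorem IsFrame.exists_causal_eigenvector (he : IsFrame g e) {S : LinearMap.BilinForm ℝ V}
    (hsymm : S.IsSymm) (hS : ∀ u, IsFutureCausal g (e 0) u → 0 ≤ S u u) :
    ∃ (u : V) (μ : ℝ), IsFutureCausal g (e 0) u ∧ ∀ x, S u x = μ * g u x := by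
  obtain ⟨l, hl, u, hu, hul⟩ := he.exists_apply_self_eq_mul hS
  have hQsymm : (S - l • g).IsSymm := hsymm.sub (he.isSymm.smul l)
  have hQu : (S - l • g) u u = 0 := by simp [hul]
  obtain ⟨c, hc⟩ := he.exists_eq_mul_of_nonneg hu (q := (S - l • g) u) (fun v hv =>
    he.apply_nonneg_of_apply_self_eq_zero hQsymm (fun v hv => by simpa using hl v hv) hu hQu hv)
    hQu
  refine ⟨u, l + c, hu, fun x => ?_⟩
  have := hc x
  simp only [LinearMap.sub_apply, LinearMap.smul_apply, smul_eq_mul] at this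
  linarith

end Cone

/-! ### Frames of eigenvectors -/

section Diagonalization

variable {V : Type*} [AddCommGroup V] [Module ℝ V] {N : ℕ} {g : LinearMap.BilinForm ℝ V}
  {e : Module.Basis (Fin N) ℝ V}

theorem exists_orthonormal_eigenfamily [FiniteDimensional ℝ V] {B T : LinearMap.BilinForm ℝ V}
    (hB : B.IsSymm) (hpos : ∀ x, x ≠ 0 → 0 < B x x) (hT : T.IsSymm) {r : ℕ}
    (hr : Module.finrank ℝ V = r) :
    ∃ (w : Fin r → V) (ρ : Fin r → ℝ), Antitone ρ ∧
      (∀ i j, B (w i) (w j) = if i = j then 1 else 0) ∧ ∀ i x, T (w i) x = ρ i * B (w i) x := by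
  have hnonneg : ∀ x, 0 ≤ B x x := fun x => by
    rcases eq_or_ne x 0 with rfl | hx
    · rw [map_zero]
    · exact (hpos x hx).le
  let core : InnerProductSpace.Core ℝ V :=
    { inner := fun x y => B x y
      conj_inner_symm := fun x y => hB.eq y x
      re_inner_nonneg := hnonneg
      add_left := fun x y z => by rw [map_add, LinearMap.add_apply]
      smul_left := fun x y c => by rw [map_smul, LinearMap.smul_apply]; rfl
      definite := fun x hx => by
        by_contra h
        exact (hpos x h).ne' hx }
  let _ : NormedAddCommGroup V := core.toNormedAddCommGroup
  let _ : InnerProductSpace ℝ V := InnerProductSpace.ofCore core.toCore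
  have hnd : B.Nondegenerate :=
    (B.nondegenerate_iff' hnonneg (LinearMap.BilinForm.isSymm_iff.1 hB)).2 hpos
  have inner_apply : ∀ x y, inner ℝ (T.symmCompOfNondegenerate B hnd x) y = T x y := fun x y =>
    T.symmCompOfNondegenerate_left_apply hnd y x
  have hsymm : (T.symmCompOfNondegenerate B hnd).IsSymmetric := fun x y => by
    rw [inner_apply, real_inner_comm, inner_apply, hT.eq]
  refine ⟨hsymm.eigenvectorBasis hr, hsymm.eigenvalues hr, hsymm.eigenvalues_antitone hr,
    orthonormal_iff_ite.1 (hsymm.eigenvectorBasis hr).orthonormal, fun i x => ?_⟩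
  rw [← inner_apply, hsymm.apply_eigenvectorBasis hr i, inner_smul_left]
  rfl

/-- Orthonormal vectors, the first of which is timelike and the others spacelike. -/
def IsOrthonormal (g : LinearMap.BilinForm ℝ V) {p : ℕ} (v : Fin p → V) : Prop :=
  ∀ i j, g (v i) (v j) = if i = j then sig i else 0

theorem IsOrthonormal.linearIndependent {p : ℕ} {v : Fin p → V} (hv : IsOrthonormal g v) :
    LinearIndependent ℝ v := by
  refine LinearMap.linearIndependent_of_isOrthoᵢ (B := g) (fun i j hij => ?_) fun i h => ?_
  · exact (hv i j).trans (if_neg hij)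
  · have hsig : sig i = 0 := ((hv i i).trans (if_pos rfl)).symm.trans h
    simpa [hsig] using sig_mul_self i

theorem IsOrthonormal.exists_isFrame [FiniteDimensional ℝ V] (hN : Module.finrank ℝ V = N)
    {f : Fin N → V} (hf : IsOrthonormal g f) :
    ∃ b : Module.Basis (Fin N) ℝ V, ⇑b = f ∧ IsFrame g b := by
  have hb := coe_basisOfLinearIndependentOfCardEqFinrank' f hf.linearIndependent (by simp [hN])
  exact ⟨_, hb, fun i j => by rw [hb]; exact hf i j⟩

theorem isOrthonormal_append (hg : g.IsSymm) {s r : ℕ} {v : Fin (s + 1) → V} {w : Fin r → V}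
    (hv : IsOrthonormal g v) (hw : ∀ i j, g (w i) (w j) = if i = j then -1 else 0)
    (hvw : ∀ i j, g (v i) (w j) = 0) : IsOrthonormal g (Fin.append v w) := by
  intro i j
  have hne (i : Fin (s + 1)) (j : Fin r) : Fin.castAdd r i ≠ Fin.natAdd (s + 1) j :=
    Fin.ne_of_val_ne (by simp only [Fin.val_castAdd, Fin.val_natAdd]; omega)
  refine Fin.addCases (fun i => ?_) (fun i => ?_) i <;>
    refine Fin.addCases (fun j => ?_) (fun j => ?_) j
  · simp [hv i j, sig]
  · simp [hvw, hne]
  · simp [hg.eq (w i), hvw, (hne _ _).symm]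
  · simp [hw, sig]

theorem IsFrame.nondegenerate (he : IsFrame g e) : g.Nondegenerate := by
  refine he.isSymm.isRefl.nondegenerate_iff_separatingLeft.2 fun x hx => ?_
  exact e.ext_elem fun i => by rw [← he.apply_raised, hx, map_zero, Finsupp.zero_apply]

theorem IsFrame.apply_self_neg (he : IsFrame g e) {u x : V} (hu : 0 < g u u) (hux : g u x = 0)
    (hx : x ≠ 0) : g x x < 0 := by
  cases N with
  | zero => exact absurd (e.ext_elem finZeroElim) hx
  | succ n =>
    by_contra! h
    exact hx (he.eq_zero_of_orthogonal hu hux h)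

theorem mem_orthogonal_span_range {ι : Type*} {v : ι → V} {x : V} :
    x ∈ g.orthogonal (Submodule.span ℝ (Set.range v)) ↔ ∀ i, g (v i) x = 0 :=
  (Submodule.span_le (p := (g.flip x).ker)).trans Set.range_subset_iff

theorem IsFrame.exists_eigenfamily_orthogonal (he : IsFrame g e) {S : LinearMap.BilinForm ℝ V}
    (hS : S.IsSymm) {s r : ℕ} (hN : N = s + 1 + r) {v : Fin (s + 1) → V}
    (hv : IsOrthonormal g v) :
    ∃ (w : Fin r → V) (ρ : Fin r → ℝ), Antitone ρ ∧
      (∀ i j, g (w i) (w j) = if i = j then -1 else 0) ∧ (∀ i j, g (v i) (w j) = 0) ∧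
      ∀ i x, (∀ j, g (v j) x = 0) → S (w i) x = ρ i * g (w i) x := by
  have : FiniteDimensional ℝ V := e.finiteDimensional_of_finite
  set U := g.orthogonal (Submodule.span ℝ (Set.range v))
  have hdim : Module.finrank ℝ U = r := by
    rw [LinearMap.BilinForm.finrank_orthogonal he.nondegenerate,
      finrank_span_eq_card hv.linearIndependent, Module.finrank_eq_card_basis e, Fintype.card_fin,
      Fintype.card_fin, hN, Nat.add_sub_cancel_left]
  have orthogonal (x : U) : ∀ i, g (v i) x = 0 := mem_orthogonal_span_range.1 x.2
  obtain ⟨w, ρ, hρ, hw, hSw⟩ := exists_orthonormal_eigenfamily (B := -g.restrict U)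
    (T := -S.restrict U) (he.isSymm.restrict U).neg (fun x hx => neg_pos.2 <|
      he.apply_self_neg (by rw [hv, if_pos rfl, sig_zero]; exact one_pos) (orthogonal x 0)
        (by simpa using hx)) (hS.restrict U).neg hdim
  simp only [LinearMap.neg_apply, LinearMap.BilinForm.restrict_apply, mul_neg, neg_inj,
    LinearMap.domRestrict_apply] at hw hSw
  refine ⟨fun i => w i, ρ, hρ, fun i j => ?_, fun i j => orthogonal (w j) i, fun i x hx =>
    hSw i ⟨x, mem_orthogonal_span_range.2 hx⟩⟩
  rw [← neg_neg (g _ _), hw]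
  split_ifs <;> simp

theorem IsFrame.exists_isFrame_extending (he : IsFrame g e) {S : LinearMap.BilinForm ℝ V}
    (hS : S.IsSymm) {s : ℕ} (hs : s + 1 ≤ N) {v : Fin (s + 1) → V} (hv : IsOrthonormal g v) :
    ∃ (f : Module.Basis (Fin N) ℝ V) (ρ : Fin N → ℝ), IsFrame g f ∧
      (∀ i, f (Fin.castLE hs i) = v i) ∧ (∀ i j, s < i.val → i ≤ j → ρ j ≤ ρ i) ∧
      ∀ i, s < i.val → ∀ x, (∀ j, g (v j) x = 0) → S (f i) x = ρ i * g (f i) x := by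
  obtain ⟨r, rfl⟩ := Nat.exists_eq_add_of_le hs
  have : FiniteDimensional ℝ V := e.finiteDimensional_of_finite
  obtain ⟨w, ρ, hρ, hw, hvw, hSw⟩ := he.exists_eigenfamily_orthogonal hS rfl hv
  obtain ⟨f, hf, hfg⟩ := (isOrthonormal_append he.isSymm hv hw hvw).exists_isFrame
    ((Module.finrank_eq_card_basis e).trans (Fintype.card_fin _))
  refine ⟨f, Fin.append (fun _ => 0) ρ, hfg, fun i => ?_, fun i j => ?_, fun i => ?_⟩
  · rw [hf]
    exact Fin.append_left v w i
  · refine Fin.addCases (fun i => ?_) (fun i => ?_) i <;>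
      refine Fin.addCases (fun j => ?_) (fun j => ?_) j <;>
      intro hi hij <;> simp only [Fin.le_def, Fin.val_castAdd, Fin.val_natAdd] at hi hij
    · omega
    · omega
    · omega
    · simpa only [Fin.append_right] using hρ (Fin.le_def.2 (by omega))
  · refine Fin.addCases (fun i hi => absurd hi (by simp; omega)) (fun i _ => ?_) i
    simpa only [hf, Fin.append_right] using hSw i

end Diagonalization

/-! ### Normal form of dominant tensors -/

section NormalForm

variable {V : Type*} [AddCommGroup V] [Module ℝ V] {n : ℕ} {g S : LinearMap.BilinForm ℝ V}
  {e : Module.Basis (Fin (n + 2)) ℝ V}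

/-- The normal form of a tensor `S` with the dominant property: in the frame `f` it is diagonal
with eigenvalues `ρ i`, up to `β` times the square of the 1-form of the null vector `f 0 + f 1`. -/
structure IsNormalForm (g S : LinearMap.BilinForm ℝ V) (f : Module.Basis (Fin (n + 2)) ℝ V)
    (ρ : Fin (n + 2) → ℝ) (β : ℝ) : Prop where
  isFrame : IsFrame g f
  antitone : Antitone ρ
  neg_le : ∀ i, -ρ 0 ≤ ρ i
  nonneg : 0 ≤ β
  one_eq_zero : β ≠ 0 → ρ 1 = ρ 0
  apply_eq : ∀ i x,
    S (f i) x = ρ i * g (f i) x + β * (g (f 0 + f 1) (f i) * g (f 0 + f 1) x)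

theorem IsFrame.exists_isFrame_of_prefix {N : ℕ} {e : Module.Basis (Fin N) ℝ V}
    (he : IsFrame g e) (hS : S.IsSymm) {s : ℕ} (hs : s + 1 ≤ N) {v : Fin (s + 1) → V}
    (hv : IsOrthonormal g v) {l β : ℝ} {w : V} (hl : 0 ≤ l)
    (hvS : ∀ i x, S (v i) x = l * g (v i) x + β * (g w (v i) * g w x))
    (hw : ∀ x, (∀ i, g (v i) x = 0) → g w x = 0)
    (hbound : ∀ x, (∀ i, g (v i) x = 0) → l * g x x ≤ S x x ∧ S x x ≤ -l * g x x) :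
    ∃ (f : Module.Basis (Fin N) ℝ V) (ρ : Fin N → ℝ), IsFrame g f ∧
      (∀ i, f (Fin.castLE hs i) = v i) ∧ Antitone ρ ∧ (∀ i, -l ≤ ρ i) ∧
      (∀ i, i.val ≤ s → ρ i = l) ∧
      ∀ i x, S (f i) x = ρ i * g (f i) x + β * (g w (f i) * g w x) := by
  obtain ⟨f, ρ, hf, hfv, hρ, hfS⟩ := he.exists_isFrame_extending hS hs hv
  have head (i : Fin N) (hi : i.val ≤ s) : f i = v ⟨i, Nat.lt_succ_of_le hi⟩ := by
    rw [← hfv, Fin.castLE_mk]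
  have orthogonal (i : Fin N) (hi : s < i.val) (j : Fin (s + 1)) : g (v j) (f i) = 0 := by
    rw [← hfv, hf, if_neg (Fin.ne_of_val_ne (by rw [Fin.val_castLE]; omega))]
  have bounds (i : Fin N) (hi : s < i.val) : -l ≤ ρ i ∧ ρ i ≤ l := by
    have hself : g (f i) (f i) = -1 := by rw [hf, if_pos rfl, sig, if_neg (by omega)]
    have := hbound _ (orthogonal i hi)
    rw [hfS i hi _ (orthogonal i hi), hself] at this
    constructor <;> linarith [this.1, this.2]
  have tail_apply (i : Fin N) (hi : s < i.val) : S (f i) = ρ i • g (f i) := f.ext fun j => by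
    rcases le_or_gt j.val s with hj | hj
    · rw [LinearMap.smul_apply, hS.eq, he.symm, head j hj, hvS, orthogonal i hi,
        hw _ (orthogonal i hi)]
      simp
    · exact hfS i hi _ (orthogonal j hj)
  refine ⟨f, fun i => if i.val ≤ s then l else ρ i, hf, hfv, fun i j hij => ?_, fun i => ?_,
    fun i hi => if_pos hi, fun i x => ?_⟩ <;> dsimp only
  · have hij : i.val ≤ j.val := hij
    split_ifs with hj hi hi
    · exact le_rfl
    · omega
    · exact (bounds j (not_le.1 hj)).2
    · exact hρ i j (not_le.1 hi) hij
  · split_ifs with hi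
    · linarith
    · exact (bounds i (not_le.1 hi)).1
  · split_ifs with hi
    · rw [head i hi, hvS]
    · rw [tail_apply i (not_le.1 hi), hw _ (orthogonal i (not_le.1 hi))]
      simp

theorem IsFrame.exists_smul_unit_future (he : IsFrame g e) {u : V} (hu : 0 < g u u) :
    ∃ c : ℝ, g (c • u) (c • u) = 1 ∧ IsFutureCausal g (e 0) (c • u) := by
  have hne : g (e 0) u ≠ 0 := fun h => by
    rw [he.eq_zero_of_apply_zero hu.le h, map_zero] at hu
    exact hu.ne rfl
  have hsq : √(g u u) * √(g u u) = g u u := Real.mul_self_sqrt hu.le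
  have hunit (c : ℝ) (hc : c * c = 1) :
      g ((c / √(g u u)) • u) ((c / √(g u u)) • u) = 1 := by
    simp only [map_smul, LinearMap.smul_apply, smul_eq_mul]
    rw [← mul_assoc, div_mul_div_comm, hc, hsq, one_div_mul_cancel hu.ne']
  have hfuture (c : ℝ) (hc : c * c = 1) (h : 0 < c * g (e 0) u) :
      IsFutureCausal g (e 0) ((c / √(g u u)) • u) := by
    refine ⟨(hunit c hc).symm ▸ zero_le_one, ?_⟩
    rw [map_smul, smul_eq_mul, div_mul_eq_mul_div]
    exact div_pos h (Real.sqrt_pos.2 hu)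
  rcases hne.lt_or_gt with h | h
  · exact ⟨_, hunit (-1) (by norm_num), hfuture (-1) (by norm_num) (by linarith)⟩
  · exact ⟨_, hunit 1 (by norm_num), hfuture 1 (by norm_num) (by linarith)⟩

theorem IsFrame.eigenvalue_nonneg (he : IsFrame g e) (hdom : Dominant g (e 0) S) {u : V} {l : ℝ}
    (hu : IsFutureCausal g (e 0) u) (hul : ∀ x, S u x = l * g u x) : 0 ≤ l := by
  have := hdom _ _ hu he.isFutureCausal_zero
  rw [hul, he.symm] at this
  exact nonneg_of_mul_nonneg_left this hu.2

theorem IsFrame.abs_apply_self_le_of_timelike (he : IsFrame g e) (hS : S.IsSymm)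
    (hdom : Dominant g (e 0) S) {v : V} {l : ℝ} (hv : IsFutureCausal g (e 0) v) (hvv : g v v = 1)
    (hvl : ∀ x, S v x = l * g v x) {x : V} (hx : g v x = 0) :
    |S x x| ≤ -l * g x x := by
  rcases eq_or_ne x 0 with rfl | hx0
  · simp
  have hneg : g x x < 0 := he.apply_self_neg (hvv.symm ▸ zero_lt_one) hx hx0
  set q := √(-g x x)
  have hq : 0 < q := Real.sqrt_pos.2 (neg_pos.2 hneg)
  have hqq : q * q = -g x x := Real.mul_self_sqrt (neg_nonneg.2 hneg.le)
  have null_future (c : ℝ) (hc : c * c = 1) : IsFutureCausal g (e 0) (q • v + c • x) := by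
    refine he.isFutureCausal_of_apply_pos hv (le_of_eq ?_) ?_ <;>
      simp only [map_add, map_smul, LinearMap.add_apply, LinearMap.smul_apply, smul_eq_mul, hvv, hx,
        he.symm x v]
    · linear_combination -hqq - g x x * hc
    · linarith
  have dominated (c : ℝ) (hc : c * c = 1) : 0 ≤ q * q * l + c * S x x := by
    have := hdom _ _ (null_future 1 (one_mul 1)) (null_future c hc)
    simp only [map_add, map_smul, LinearMap.add_apply, LinearMap.smul_apply, smul_eq_mul, hvl, hvv,
      hS.eq x v, hx] at this
    linarith
  rw [hqq] at dominated
  rw [abs_le]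
  constructor
  · linarith [dominated 1 (by norm_num)]
  · linarith [dominated (-1) (by norm_num)]

theorem IsFrame.exists_isNormalForm_of_timelike (he : IsFrame g e) (hS : S.IsSymm)
    (hdom : Dominant g (e 0) S) {u : V} {l : ℝ} (hu : 0 < g u u)
    (hul : ∀ x, S u x = l * g u x) :
    ∃ (f : Module.Basis (Fin (n + 2)) ℝ V) (ρ : Fin (n + 2) → ℝ), IsNormalForm g S f ρ 0 := by
  obtain ⟨c, hunit, hfuture⟩ := he.exists_smul_unit_future hu
  have hcl (x : V) : S (c • u) x = l * g (c • u) x := by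
    simp only [map_smul, LinearMap.smul_apply, hul, smul_eq_mul, mul_left_comm]
  obtain ⟨f, ρ, hf, -, hρ, hneg, hl, hfS⟩ := he.exists_isFrame_of_prefix hS (s := 0) (by omega)
    (v := fun _ => c • u) (β := 0) (w := 0)
    (fun i j => by
      rw [hunit, if_pos (Subsingleton.elim (α := Fin 1) i j), Subsingleton.elim (α := Fin 1) i 0,
        sig_zero])
    (he.eigenvalue_nonneg hdom hfuture hcl) (fun _ x => by rw [hcl, zero_mul, add_zero])
    (fun x _ => by simp) fun x hx => by
      have := abs_le.1 (he.abs_apply_self_le_of_timelike hS hdom hfuture hunit hcl (hx 0))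
      exact ⟨by linarith [this.1], this.2⟩
  refine ⟨f, ρ, hf, hρ, ?_, le_rfl, fun h => absurd rfl h, fun i x => ?_⟩
  · rwa [hl 0 le_rfl]
  · rw [hfS, zero_mul, zero_mul]

theorem exists_apply_self_smul_add_eq (hg : g.IsSymm) {k x : V} (hkk : g k k = 0)
    (hkx : g k x ≠ 0) (c : ℝ) : ∃ s : ℝ, g (s • k + x) (s • k + x) = c := by
  refine ⟨(c - g x x) / (2 * g k x), ?_⟩
  simp only [map_add, map_smul, LinearMap.add_apply, LinearMap.smul_apply, smul_eq_mul, hkk,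
    hg.eq x k]
  field_simp
  ring

theorem IsFrame.mul_apply_self_le_of_null (he : IsFrame g e) (hS : S.IsSymm)
    (hdom : Dominant g (e 0) S) {k : V} {l : ℝ} (hk : IsFutureCausal g (e 0) k)
    (hkk : g k k = 0) (hkl : ∀ x, S k x = l * g k x) (x : V) : l * g x x ≤ S x x := by
  have of_pos {w : V} (hw : 0 < g k w) : l * g w w ≤ S w w := by
    obtain ⟨s, hs⟩ := exists_apply_self_smul_add_eq he.isSymm hkk hw.ne' 0
    have future : IsFutureCausal g (e 0) (s • k + w) :=
      he.isFutureCausal_of_apply_pos hk hs.ge (by simpa [hkk] using hw)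
    have := hdom _ _ future future
    simp only [map_add, map_smul, LinearMap.add_apply, LinearMap.smul_apply, smul_eq_mul, hkk,
      hkl, hS.eq w k, he.symm w k] at this hs
    linear_combination this + l * hs
  rcases lt_trichotomy (g k x) 0 with hx | hx | hx
  · simpa using of_pos (w := -x) (by simpa using hx)
  · have hke : 0 < g k (e 0) := he.symm k (e 0) ▸ hk.2
    refine sub_nonneg.1 (nonneg_of_forall_nonneg_add_mul
      (C := S (e 0) (e 0) - l * g (e 0) (e 0)) fun t ht => ?_)
    have pencil (a : ℝ) := of_pos (w := e 0 + a • x) (by simpa [hx] using hke)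
    have hplus := pencil √t
    have hminus := pencil (-√t)
    have hsq : √t * √t = t := Real.mul_self_sqrt ht.le
    simp only [map_add, map_smul, LinearMap.add_apply, LinearMap.smul_apply, smul_eq_mul,
      hS.eq x (e 0), he.symm x (e 0)] at hplus hminus
    linear_combination (hplus + hminus) / 2 + hsq * (S x x - l * g x x)
  · exact of_pos hx

theorem exists_apply_eq_of_ker_le [FiniteDimensional ℝ V] {Q : LinearMap.BilinForm ℝ V}
    (hQ : Q.IsSymm) {φ : Module.Dual ℝ V} (hφ : ∀ x, Q x = 0 → φ x = 0) : ∃ u, Q u = φ := by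
  have hflip : LinearMap.flip Q = Q := LinearMap.ext₂ fun x y => hQ.eq y x
  rw [← LinearMap.mem_range, ← hflip, ← LinearMap.dualAnnihilator_ker_eq_range_flip,
    Submodule.mem_dualAnnihilator]
  exact hφ

theorem IsFrame.exists_timelike_of_null (he : IsFrame g e) (hS : S.IsSymm)
    (hdom : Dominant g (e 0) S) {k : V} {l : ℝ} (hk : IsFutureCausal g (e 0) k)
    (hkk : g k k = 0) (hkl : ∀ x, S k x = l * g k x)
    (hno : ∀ u, 0 < g u u → ¬∀ x, S u x = l * g u x) :
    ∃ u, 0 < g u u ∧ 0 < g k u ∧ ∀ x, S u x = l * g u x + g k x := by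
  have : FiniteDimensional ℝ V := e.finiteDimensional_of_finite
  set Q := S - l • g
  have hQ : Q.IsSymm := hS.sub (he.isSymm.smul l)
  have Q_apply (x y : V) : Q x y = S x y - l * g x y := rfl
  have ker_le (x : V) (hx : Q x = 0) : g k x = 0 := by
    by_contra hkx
    obtain ⟨s, hs⟩ := exists_apply_self_smul_add_eq he.isSymm hkk hkx 1
    refine hno (s • k + x) (hs ▸ one_pos) fun y => ?_
    have hxy : S x y - l * g x y = 0 := by rw [← Q_apply, hx, LinearMap.zero_apply]
    simp only [map_add, map_smul, LinearMap.add_apply, LinearMap.smul_apply, smul_eq_mul, hkl]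
    linear_combination hxy
  obtain ⟨u, hu⟩ := exists_apply_eq_of_ker_le hQ ker_le
  have hQ_nonneg (x : V) : 0 ≤ Q x x :=
    sub_nonneg.2 (he.mul_apply_self_le_of_null hS hdom hk hkk hkl x)
  have hku : 0 < g k u := by
    rw [← hu]
    refine (hQ_nonneg u).lt_of_ne' fun h => ?_
    have hzero : Q u = 0 := LinearMap.mem_ker.1 <|
      (Q.apply_apply_same_eq_zero_iff hQ_nonneg (LinearMap.BilinForm.isSymm_iff.1 hQ)).1 h
    have := he.symm k (e 0) ▸ hk.2
    rw [← hu, hzero, LinearMap.zero_apply] at this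
    exact this.false
  obtain ⟨s, hs⟩ := exists_apply_self_smul_add_eq he.isSymm hkk hku.ne' 1
  refine ⟨s • k + u, hs ▸ one_pos, by simpa [hkk] using hku, fun x => ?_⟩
  have hux : S u x - l * g u x = g k x := by rw [← Q_apply, hu]
  simp only [map_add, map_smul, LinearMap.add_apply, LinearMap.smul_apply, smul_eq_mul, hkl]
  linear_combination hux

theorem IsFrame.apply_self_le_of_null (he : IsFrame g e) (hS : S.IsSymm)
    (hdom : Dominant g (e 0) S) {v m x : V} {l β : ℝ} (hv : IsFutureCausal g (e 0) v)
    (hvv : g v v = 1) (hmv : g m v = 1) (hmm : g m m = 0) (hml : ∀ x, S m x = l * g m x)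
    (hvl : ∀ x, S v x = l * g v x + β * g m x) (hvx : g v x = 0) (hmx : g m x = 0) :
    S x x ≤ -l * g x x := by
  have hxx : g x x ≤ 0 := by
    by_contra! h
    have := he.eq_zero_of_orthogonal (hvv.symm ▸ one_pos) hvx h.le
    simp [this] at h
  have unit_future (a : ℝ) :
      IsFutureCausal g (e 0) (v + a • x + (-(a * a * g x x) / 2) • m) := by
    refine he.isFutureCausal_of_apply_pos hv (zero_le_one.trans_eq ?_) ?_ <;>
      simp only [map_add, map_smul, LinearMap.add_apply, LinearMap.smul_apply, smul_eq_mul, hvv,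
        hvx, hmx, hmv, hmm, he.symm v m, he.symm x m, he.symm x v]
    · ring
    · nlinarith [mul_nonneg (mul_self_nonneg a) (neg_nonneg.2 hxx)]
  refine sub_nonneg.1 (nonneg_of_forall_nonneg_add_mul (C := l + β) fun t ht => ?_)
  have dominated := hdom _ _ (unit_future √t) (unit_future (-√t))
  have hsq : √t * √t = t := Real.mul_self_sqrt ht.le
  simp only [map_add, map_smul, LinearMap.add_apply, LinearMap.smul_apply, smul_eq_mul, neg_mul_neg,
    hsq, hvl, hml, hS.eq x v, hS.eq x m, hvv, hvx, hmx, hmv, hmm, he.symm v m] at dominated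
  linear_combination dominated - hsq * S x x

theorem IsFrame.exists_adapted_pair_of_null (he : IsFrame g e) (hS : S.IsSymm)
    (hdom : Dominant g (e 0) S) {k : V} {l : ℝ} (hk : IsFutureCausal g (e 0) k)
    (hkk : g k k = 0) (hkl : ∀ x, S k x = l * g k x)
    (hno : ∀ u, 0 < g u u → ¬∀ x, S u x = l * g u x) :
    ∃ v m β, IsFutureCausal g (e 0) v ∧ g v v = 1 ∧ g m v = 1 ∧ g m m = 0 ∧ 0 ≤ β ∧
      (∀ x, S m x = l * g m x) ∧ ∀ x, S v x = l * g v x + β * g m x := by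
  obtain ⟨u, huu, hku, hul⟩ := he.exists_timelike_of_null hS hdom hk hkk hkl hno
  obtain ⟨c, hunit, hfuture⟩ := he.exists_smul_unit_future huu
  have hc : c ≠ 0 := by
    rintro rfl
    simp at hunit
  have hcku : c * g k u ≠ 0 := mul_ne_zero hc hku.ne'
  refine ⟨c • u, (c * g k u)⁻¹ • k, c * (c * g k u), hfuture, hunit, ?_, ?_, ?_, fun x => ?_,
    fun x => ?_⟩
  · simp only [map_smul, LinearMap.smul_apply, smul_eq_mul]
    rw [mul_left_comm, inv_mul_cancel₀ hcku]
  · simp [hkk]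
  · rw [← mul_assoc]
    exact mul_nonneg (mul_self_nonneg c) hku.le
  · simp only [map_smul, LinearMap.smul_apply, hkl, smul_eq_mul, mul_left_comm]
  · simp only [map_smul, LinearMap.smul_apply, hul, smul_eq_mul]
    rw [mul_assoc, mul_inv_cancel_left₀ hcku, mul_add, mul_left_comm]

theorem IsFrame.exists_isNormalForm_of_null (he : IsFrame g e) (hS : S.IsSymm)
    (hdom : Dominant g (e 0) S) {k : V} {l : ℝ} (hk : IsFutureCausal g (e 0) k)
    (hkk : g k k = 0) (hkl : ∀ x, S k x = l * g k x)
    (hno : ∀ u, 0 < g u u → ¬∀ x, S u x = l * g u x) :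
    ∃ (f : Module.Basis (Fin (n + 2)) ℝ V) (ρ : Fin (n + 2) → ℝ) (β : ℝ),
      IsNormalForm g S f ρ β := by
  obtain ⟨v, m, β, hv, hvv, hmv, hmm, hβ, hml, hvl⟩ :=
    he.exists_adapted_pair_of_null hS hdom hk hkk hkl hno
  have orthogonal {x : V} (hx : ∀ i, g (![v, m - v] i) x = 0) : g v x = 0 ∧ g m x = 0 := by
    have h0 : g v x = 0 := hx 0
    have h1 : g (m - v) x = 0 := hx 1
    rw [map_sub, LinearMap.sub_apply, h0, sub_zero] at h1
    exact ⟨h0, h1⟩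
  obtain ⟨f, ρ, hf, hfv, hρ, hneg, hρl, hfS⟩ := he.exists_isFrame_of_prefix hS (s := 1) (by omega)
    (v := ![v, m - v]) (β := β) (w := m)
    (fun i j => by fin_cases i <;> fin_cases j <;> simp [sig, hvv, hmv, hmm, he.symm v m])
    (he.eigenvalue_nonneg hdom hk hkl)
    (fun i x => by fin_cases i <;> simp [hvl, hml, hmv, hmm]; ring)
    (fun x hx => (orthogonal hx).2)
    fun x hx => ⟨he.mul_apply_self_le_of_null hS hdom hk hkk hkl x,
      he.apply_self_le_of_null hS hdom hv hvv hmv hmm hml hvl (orthogonal hx).1 (orthogonal hx).2⟩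
  have h0 : ρ 0 = l := hρl 0 (by simp)
  have h1 : ρ 1 = l := hρl 1 (by simp)
  have hm_eq : f 0 + f 1 = m := by
    rw [show f 0 = v from hfv 0, show f 1 = m - v from hfv 1, add_sub_cancel]
  exact ⟨f, ρ, _, hf, hρ, h0 ▸ hneg, hβ, fun _ => h1.trans h0.symm, hm_eq ▸ hfS⟩

theorem IsFrame.exists_isNormalForm (he : IsFrame g e) (hS : S.IsSymm)
    (hdom : Dominant g (e 0) S) :
    ∃ (f : Module.Basis (Fin (n + 2)) ℝ V) (ρ : Fin (n + 2) → ℝ) (β : ℝ),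
      IsNormalForm g S f ρ β := by
  by_cases! htimelike : ∃ u l, 0 < g u u ∧ ∀ x, S u x = l * g u x
  · obtain ⟨u, l, huu, hul⟩ := htimelike
    obtain ⟨f, ρ, h⟩ := he.exists_isNormalForm_of_timelike hS hdom huu hul
    exact ⟨f, ρ, 0, h⟩
  · obtain ⟨k, l, hk, hkl⟩ := he.exists_causal_eigenvector hS fun u hu => hdom u u hu hu
    have no_timelike (u : V) (huu : 0 < g u u) (l : ℝ) : ¬∀ x, S u x = l * g u x :=
      not_forall.2 (htimelike u l huu)
    have hkk : g k k = 0 := hk.1.eq_of_not_lt' fun h => no_timelike k h l hkl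
    exact he.exists_isNormalForm_of_null hS hdom hk hkk hkl fun u huu => no_timelike u huu l

end NormalForm

/-! ### Flags and null bases -/

section ExteriorProducts

variable {V : Type*} [AddCommGroup V] [Module ℝ V] {g : LinearMap.BilinForm ℝ V}

theorem wedgeVec_smul {p : ℕ} (c : Fin p → ℝ) (v : Fin p → V) :
    wedgeVec g (fun i => c i • v i) = (∏ i, c i) • wedgeVec g v := by
  ext x
  rw [AlternatingMap.smul_apply, wedgeVec_apply, wedgeVec_apply, smul_eq_mul,
    ← Matrix.det_mul_column]
  congr 1
  ext i j
  simp [gramMatrix]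

theorem wedgeVec_sum_smul {p : ℕ} (M : Matrix (Fin p) (Fin p) ℝ) (w : Fin p → V) :
    wedgeVec g (fun i => ∑ j, M i j • w j) = M.det • wedgeVec g w := by
  ext x
  rw [AlternatingMap.smul_apply, wedgeVec_apply, wedgeVec_apply, smul_eq_mul, ← Matrix.det_mul]
  congr 1
  ext i j
  simp [gramMatrix, Matrix.mul_apply]

theorem exists_wedgeVec_eq_smul {p : ℕ} {v w : Fin p → V} (hv : LinearIndependent ℝ v)
    (h : ∀ i, v i ∈ Submodule.span ℝ (Set.range w)) :
    ∃ c : ℝ, c ≠ 0 ∧ wedgeVec g v = c • wedgeVec g w := by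
  choose M hM using fun i => (Submodule.mem_span_range_iff_exists_fun ℝ).1 (h i)
  obtain rfl : (fun i => ∑ j, M i j • w j) = v := funext hM
  have rows : LinearIndependent ℝ (Matrix.of M).row :=
    LinearIndependent.of_comp (Fintype.linearCombination ℝ w) hv
  have hM_unit := Matrix.linearIndependent_rows_iff_isUnit.1 rows
  exact ⟨_, ((Matrix.isUnit_iff_isUnit_det _).1 hM_unit).ne_zero, wedgeVec_sum_smul (Matrix.of M) w⟩

theorem exists_smul_wedgeVec_eq {p : ℕ} {v w : Fin p → V} (hv : LinearIndependent ℝ v)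
    (hvw : ∀ i, v i ∈ Submodule.span ℝ (Set.range w)) (a : ℝ) :
    ∃ c : ℝ, (a ≠ 0 → c ≠ 0) ∧ a • wedgeVec g w = c • wedgeVec g v := by
  obtain ⟨c, hc, hcv⟩ := exists_wedgeVec_eq_smul hv hvw
  exact ⟨a / c, fun ha => div_ne_zero ha hc, by rw [hcv, smul_smul, div_mul_cancel₀ _ hc]⟩

theorem isSimple_wedgeVec (hg : g.Nondegenerate) {p : ℕ} {v : Fin p → V}
    (hv : LinearIndependent ℝ v) : IsSimple (wedgeVec g v) :=
  ⟨_, hv.map' g hg.ker_eq_bot, rfl⟩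

theorem smul_wedgeVec_eq_zero_or_isSimple (hg : g.Nondegenerate) {p : ℕ} (hp : 1 ≤ p)
    {v : Fin p → V} (hv : LinearIndependent ℝ v) (a : ℝ) :
    a • wedgeVec g v = 0 ∨ IsSimple (a • wedgeVec g v) := by
  rcases eq_or_ne a 0 with rfl | ha
  · exact Or.inl (zero_smul ℝ _)
  let c : Fin p → ℝˣ := Pi.mulSingle ⟨0, hp⟩ (Units.mk0 a ha)
  have hc : ∏ i, (c i : ℝ) = a := by
    rw [← Units.coe_prod, prod_pi_mulSingle', if_pos (mem_univ _), Units.val_mk0]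
  have hsimple := isSimple_wedgeVec hg (hv.units_smul c)
  right
  rw [← hc, ← wedgeVec_smul]
  exact hsimple

end ExteriorProducts

section Flag

variable {V : Type*} [AddCommGroup V] [Module ℝ V] {N : ℕ} {f : Module.Basis (Fin N) ℝ V}

theorem linearIndependent_castLE (f : Module.Basis (Fin N) ℝ V) {p : ℕ} (hp : p ≤ N) :
    LinearIndependent ℝ fun i : Fin p => f (Fin.castLE hp i) :=
  f.linearIndependent.comp _ (Fin.castLE_injective hp)

theorem span_castLE_eq_flag (f : Module.Basis (Fin N) ℝ V) {p : ℕ} (hp : p ≤ N) :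
    Submodule.span ℝ (Set.range fun i : Fin p => f (Fin.castLE hp i)) =
      f.flag ⟨p, Nat.lt_succ_of_le hp⟩ := by
  refine le_antisymm (Submodule.span_le.2 ?_) ((f.flag_le_iff).2 fun i hi => ?_)
  · rintro _ ⟨i, rfl⟩
    exact f.self_mem_flag i.is_lt
  · exact Submodule.subset_span ⟨⟨i, hi⟩, rfl⟩

theorem finrank_flag (f : Module.Basis (Fin N) ℝ V) (p : Fin (N + 1)) :
    Module.finrank ℝ (f.flag p) = p := by
  have hp : p.val ≤ N := Nat.le_of_lt_succ p.is_lt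
  calc Module.finrank ℝ (f.flag p)
      = Module.finrank ℝ (Submodule.span ℝ (Set.range fun i => f (Fin.castLE hp i))) := by
        rw [span_castLE_eq_flag f hp]
    _ = p := (finrank_span_eq_card (linearIndependent_castLE f hp)).trans (Fintype.card_fin _)

theorem span_range_eq_flag {p : Fin (N + 1)} {q : Fin p → V} (hq : LinearIndependent ℝ q)
    (hqf : ∀ i, q i ∈ f.flag p) : Submodule.span ℝ (Set.range q) = f.flag p := by
  have : FiniteDimensional ℝ V := f.finiteDimensional_of_finite
  refine Submodule.eq_of_le_of_finrank_eq ?_ ?_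
  · exact Submodule.span_le.2 (Set.range_subset_iff.2 hqf)
  · rw [finrank_flag, finrank_span_eq_card hq, Fintype.card_fin]

end Flag

section NullBasis

variable {V : Type*} [AddCommGroup V] [Module ℝ V] {g : LinearMap.BilinForm ℝ V}

theorem IsNull.smul {v : V} (hv : IsNull g v) {a : ℝ} (ha : a ≠ 0) : IsNull g (a • v) :=
  ⟨smul_ne_zero ha hv.1, by simp [hv.2]⟩

theorem linearIndependent_null_pair {u v : V} (huu : g u u = 0) (hvv : g v v = 0)
    (huv : g u v ≠ 0) : LinearIndependent ℝ ![u, v] := by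
  refine LinearIndependent.pair_iff.2 fun s t hst => ⟨?_, ?_⟩
  · have := LinearMap.congr_fun (congrArg g hst) v
    simpa [hvv, huv] using this
  · have := congrArg (g u) hst
    simpa [huu, huv] using this

/-- The vectors `m` are independent null vectors that begin with the vectors `k`, and the first
`p` of them span the same subspace as the first `p` vectors of `f` whenever they include all the
`k i` and `p ≥ 2` (a line spanned by a timelike `f 0` contains no null vector). -/
structure IsAdaptedNullBasis {N d : ℕ} (g : LinearMap.BilinForm ℝ V) (f : Module.Basis (Fin N) ℝ V)
    (k : Fin d → V) (m : Fin N → V) : Prop where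
  linearIndependent : LinearIndependent ℝ m
  isNull : ∀ i, IsNull g (m i)
  apply_eq : ∀ (i : Fin d) (j : Fin N), i.val = j.val → m j = k i
  mem_flag : ∀ p : Fin (N + 1), 2 ≤ p.val → d ≤ p.val → ∀ i, i.castSucc < p → m i ∈ f.flag p

theorem IsAdaptedNullBasis.comp_castLE {N d b : ℕ} {f : Module.Basis (Fin N) ℝ V} {k : Fin b → V}
    {m : Fin N → V} (h : IsAdaptedNullBasis g f k m) (hb : b ≤ 2) (hd : d ≤ b) :
    IsAdaptedNullBasis g f (k ∘ Fin.castLE hd) m where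
  linearIndependent := h.linearIndependent
  isNull := h.isNull
  apply_eq i := h.apply_eq (Fin.castLE hd i)
  mem_flag p hp _ := h.mem_flag p hp (hb.trans hp)

variable {n : ℕ} {f : Module.Basis (Fin (n + 2)) ℝ V}

theorem IsFrame.isNull_add_smul (hf : IsFrame g f) {i : Fin (n + 2)} (hi : i ≠ 0) {c : ℝ}
    (hc : c * c = 1) : IsNull g (f 0 + c • f i) := by
  have h00 : g (f 0) (f 0) = 1 := hf.apply_zero_zero
  have h0i : g (f 0) (f i) = 0 := (hf 0 i).trans (if_neg hi.symm)
  have hii : g (f i) (f i) = -1 := by rw [hf, if_pos rfl, sig_of_ne_zero hi]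
  refine ⟨fun h => ?_, ?_⟩
  · have := congrArg (g (f 0)) h
    simp [h00, h0i] at this
  · simp only [map_add, map_smul, LinearMap.add_apply, LinearMap.smul_apply, smul_eq_mul, h00, h0i,
      hf.symm (f i), hii]
    linear_combination -hc

theorem IsFrame.isNull_add (hf : IsFrame g f) {i : Fin (n + 2)} (hi : i ≠ 0) :
    IsNull g (f 0 + f i) := by
  simpa using hf.isNull_add_smul hi (one_mul 1)

theorem IsFrame.isNull_sub (hf : IsFrame g f) {i : Fin (n + 2)} (hi : i ≠ 0) :
    IsNull g (f 0 - f i) := by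
  simpa [sub_eq_add_neg] using hf.isNull_add_smul hi (c := -1) (by norm_num)

theorem IsFrame.exists_isAdaptedNullBasis (hf : IsFrame g f) {p : Fin (n + 3)} (hp : 1 ≤ p.val)
    {k : Fin p → V} (hk : LinearIndependent ℝ k) (hkn : ∀ i, IsNull g (k i))
    (hkf : ∀ i, k i ∈ f.flag p) : ∃ m, IsAdaptedNullBasis g f k m := by
  let m (i : Fin (n + 2)) : V := if h : i.castSucc < p then k ⟨i, h⟩ else f 0 + f i
  have m_of_lt {i : Fin (n + 2)} (h : i.castSucc < p) : m i = k ⟨i, h⟩ := dif_pos h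
  have m_of_ge {i : Fin (n + 2)} (h : ¬i.castSucc < p) : m i = f 0 + f i := dif_neg h
  have zero_lt : (0 : Fin (n + 2)).castSucc < p := hp
  have flag_le : f.flag p ≤ Submodule.span ℝ (Set.range m) := by
    rw [← span_range_eq_flag hk hkf]
    refine Submodule.span_mono (Set.range_subset_iff.2 fun i => ?_)
    exact ⟨⟨i, by omega⟩, m_of_lt (i := ⟨i, by omega⟩) i.is_lt⟩
  have top_le : ⊤ ≤ Submodule.span ℝ (Set.range m) := by
    rw [← f.span_eq, Submodule.span_le, Set.range_subset_iff]
    intro i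
    by_cases h : i.castSucc < p
    · exact flag_le (f.self_mem_flag h)
    · have hmi : m i ∈ Submodule.span ℝ (Set.range m) := Submodule.subset_span ⟨i, rfl⟩
      rw [m_of_ge h] at hmi
      exact (Submodule.add_mem_iff_right _ (flag_le (f.self_mem_flag zero_lt))).1 hmi
  refine ⟨m, linearIndependent_of_top_le_span_of_card_eq_finrank top_le
    (Module.finrank_eq_card_basis f).symm, fun i => ?_, fun i j hij => ?_,
    fun q _ hpq i hiq => ?_⟩
  · by_cases h : i.castSucc < p
    · rw [m_of_lt h]
      exact hkn _
    · rw [m_of_ge h]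
      exact hf.isNull_add fun h0 => h (h0 ▸ zero_lt)
  · have h : j.castSucc < p := Fin.lt_def.2 (hij ▸ i.is_lt)
    rw [m_of_lt h]
    exact congrArg k (Fin.ext hij.symm)
  · by_cases h : i.castSucc < p
    · rw [m_of_lt h]
      exact f.flag_mono hpq (hkf _)
    · rw [m_of_ge h]
      exact add_mem (f.self_mem_flag (zero_lt.trans_le hpq)) (f.self_mem_flag hiq)

theorem IsFrame.exists_isAdaptedNullBasis_pair (hf : IsFrame g f) {a : ℝ} (ha : a ≠ 0) :
    ∃ m, IsAdaptedNullBasis g f ![a • (f 0 + f 1), f 0 - f 1] m := by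
  have hadd := hf.isNull_add (i := 1) (by simp)
  have hsub := hf.isNull_sub (i := 1) (by simp)
  have f_mem (i : Fin (n + 2)) (hi : i.val < 2) : f i ∈ f.flag ⟨2, by omega⟩ :=
    f.self_mem_flag hi
  have hpair : g (a • (f 0 + f 1)) (f 0 - f 1) ≠ 0 := by
    have h11 : g (f 1) (f 1) = -1 := by rw [hf, if_pos rfl, sig_of_ne_zero (by simp)]
    have hval : g (a • (f 0 + f 1)) (f 0 - f 1) = a * 2 := by
      simp only [map_smul, map_add, map_sub, LinearMap.smul_apply, LinearMap.add_apply,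
        smul_eq_mul, hf.apply_zero_zero, hf.symm (f 1) (f 0), h11]
      ring
    exact hval ▸ mul_ne_zero ha two_ne_zero
  refine hf.exists_isAdaptedNullBasis (p := ⟨2, by omega⟩) one_le_two
    (linearIndependent_null_pair (hadd.smul ha).2 hsub.2 hpair) (fun i => ?_) fun i => ?_ <;>
    fin_cases i
  · exact hadd.smul ha
  · exact hsub
  · exact Submodule.smul_mem _ _ (add_mem (f_mem 0 (by simp)) (f_mem 1 (by simp)))
  · exact sub_mem (f_mem 0 (by simp)) (f_mem 1 (by simp))

end NullBasis

/-! ### The decomposition -/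

section Weight

variable {n : ℕ} {ρ : Fin (n + 1) → ℝ}

/-- The eigenvalues `ρ 0, …, ρ n` continued by `-ρ 0`, the lower bound that the dominant property
imposes on them. -/
noncomputable def extendedEigenvalue (ρ : Fin (n + 1) → ℝ) (j : ℕ) : ℝ :=
  if h : j < n + 1 then ρ ⟨j, h⟩ else -ρ 0

/-- The coefficient, in the decomposition of the diagonal tensor with eigenvalues `ρ`, of the
superenergy tensor of the first `p ≥ 1` vectors of the frame. -/
noncomputable def weight (ρ : Fin (n + 1) → ℝ) (p : ℕ) : ℝ :=
  extendedEigenvalue ρ (p - 1) - extendedEigenvalue ρ p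

theorem extendedEigenvalue_val (ρ : Fin (n + 1) → ℝ) (i : Fin (n + 1)) :
    extendedEigenvalue ρ i = ρ i :=
  dif_pos i.is_lt

theorem extendedEigenvalue_self (ρ : Fin (n + 1) → ℝ) : extendedEigenvalue ρ (n + 1) = -ρ 0 :=
  dif_neg (lt_irrefl _)

theorem antitone_extendedEigenvalue (hρ : Antitone ρ) (hneg : ∀ i, -ρ 0 ≤ ρ i) :
    Antitone (extendedEigenvalue ρ) := by
  intro i j hij
  unfold extendedEigenvalue
  split_ifs with hj hi hi
  · exact hρ hij
  · omega
  · exact hneg _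
  · exact le_rfl

theorem weight_nonneg (hρ : Antitone ρ) (hneg : ∀ i, -ρ 0 ≤ ρ i) (p : ℕ) : 0 ≤ weight ρ p :=
  sub_nonneg.2 (antitone_extendedEigenvalue hρ hneg (Nat.sub_le p 1))

theorem sum_weight (i : Fin (n + 1)) :
    ∑ p ∈ Icc (i.val + 1) (n + 1), weight ρ p = ρ i + ρ 0 := by
  have telescope (M : ℕ) (hM : i.val ≤ M) : ∑ p ∈ Icc (i.val + 1) M, weight ρ p =
      extendedEigenvalue ρ i - extendedEigenvalue ρ M := by
    induction M, hM using Nat.le_induction with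
    | base => simp
    | succ M hM ih =>
      rw [sum_Icc_succ_top (by omega), ih, weight, Nat.add_sub_cancel, sub_add_sub_cancel]
  rw [telescope _ i.is_lt.le, extendedEigenvalue_val, extendedEigenvalue_self, sub_neg_eq_add]

theorem sum_castLE_eq_sum_ite {N p : ℕ} (hp : p ≤ N) (F : Fin N → ℝ) :
    ∑ i : Fin p, F (Fin.castLE hp i) = ∑ i : Fin N, if i.val < p then F i else 0 := by
  rw [← sum_filter]
  exact sum_nbij (Fin.castLE hp) (by simp) (Fin.castLE_injective hp).injOn
    (fun i hi => ⟨⟨i, (mem_filter.1 hi).2⟩, mem_coe.2 (mem_univ _), rfl⟩) fun _ _ => rfl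

theorem sum_weight_mul_sum_castLE (ρ F : Fin (n + 1) → ℝ) :
    ∑ p ∈ Icc 1 (n + 1), weight ρ p *
      ((∑ i : Fin (n + 1), if i.val < p then F i else 0) - 1 / 2 * ∑ i, F i) =
        ∑ i, ρ i * F i := by
  have total : ∑ p ∈ Icc 1 (n + 1), weight ρ p = 2 * ρ 0 := by
    rw [two_mul]
    exact sum_weight 0
  have above (i : Fin (n + 1)) :
      ∑ p ∈ Icc 1 (n + 1), weight ρ p * (if i.val < p then F i else 0) =
        (ρ i + ρ 0) * F i := by
    simp only [mul_ite, mul_zero]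
    rw [← sum_filter, ← sum_mul, ← sum_weight i]
    congr 2
    ext p
    simp only [mem_filter, mem_Icc]
    omega
  calc _ = ∑ i, (∑ p ∈ Icc 1 (n + 1), weight ρ p * if i.val < p then F i else 0) -
        (∑ p ∈ Icc 1 (n + 1), weight ρ p) * (1 / 2 * ∑ i, F i) := by
        simp only [mul_sub, sum_sub_distrib, sum_mul]
        congr 1
        simp only [mul_sum]
        exact sum_comm
    _ = ∑ i, ρ i * F i := by
        simp only [above, total, add_mul, sum_add_distrib, ← mul_sum]
        ring

end Weight

section Decomposition

variable {V : Type*} [AddCommGroup V] [Module ℝ V] {n : ℕ} {g S : LinearMap.BilinForm ℝ V}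
  {e f : Module.Basis (Fin (n + 2)) ℝ V} {ρ : Fin (n + 2) → ℝ} {β : ℝ}

/-- The `p`-form `Ω_[p]` in the decomposition of a tensor in normal form. A non-zero `β` takes the
place of the term of degree `1`, whose weight then vanishes. -/
noncomputable def normalFormTerm (g : LinearMap.BilinForm ℝ V)
    (f : Module.Basis (Fin (n + 2)) ℝ V) (ρ : Fin (n + 2) → ℝ) (β : ℝ) (p : ℕ) :
    V [⋀^Fin p]→ₗ[ℝ] ℝ :=
  if p = 1 ∧ β ≠ 0 then √β • wedgeVec g fun _ => f 0 + f 1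
  else if hp : p ≤ n + 2 then √(weight ρ p) • wedgeVec g fun i => f (Fin.castLE hp i)
  else 0

theorem normalFormTerm_one (hβ : β ≠ 0) :
    normalFormTerm g f ρ β 1 = √β • wedgeVec g fun _ => f 0 + f 1 :=
  if_pos ⟨rfl, hβ⟩

theorem normalFormTerm_of_le {p : ℕ} (hp : p ≤ n + 2) (h : ¬(p = 1 ∧ β ≠ 0)) :
    normalFormTerm g f ρ β p = √(weight ρ p) • wedgeVec g fun i => f (Fin.castLE hp i) := by
  rw [normalFormTerm, if_neg h, dif_pos hp]

theorem IsFrame.normalFormTerm_eq_zero_or_isSimple (hf : IsFrame g f) {p : ℕ} (hp : 1 ≤ p)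
    (hpN : p ≤ n + 2) : normalFormTerm g f ρ β p = 0 ∨ IsSimple (normalFormTerm g f ρ β p) := by
  by_cases h : p = 1 ∧ β ≠ 0
  · obtain ⟨rfl, hβ⟩ := h
    rw [normalFormTerm_one hβ]
    exact smul_wedgeVec_eq_zero_or_isSimple hf.nondegenerate le_rfl
      (LinearIndependent.of_subsingleton 0 (hf.isNull_add (i := 1) (by simp)).1) _
  · rw [normalFormTerm_of_le hpN h]
    exact smul_wedgeVec_eq_zero_or_isSimple hf.nondegenerate hp (linearIndependent_castLE f hpN) _

theorem IsNormalForm.apply_eq_sum (h : IsNormalForm g S f ρ β) (x y : V) :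
    S x y = ∑ i, ρ i * (sig i * (g (f i) x * g (f i) y)) +
      β * (g (f 0 + f 1) x * g (f 0 + f 1) y) := by
  have expand (B : LinearMap.BilinForm ℝ V) (z : V) : B x z = ∑ i, f.repr x i * B (f i) z := by
    conv_lhs => rw [← f.sum_repr x]
    simp only [map_sum, map_smul, LinearMap.sum_apply, LinearMap.smul_apply, smul_eq_mul]
  have repr_eq (i : Fin (n + 2)) : f.repr x i = sig i * g (f i) x := by
    rw [h.isFrame.symm, h.isFrame.apply_right, ← mul_assoc, sig_mul_self, one_mul]
  rw [expand, h.isFrame.symm _ x, expand g]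
  simp only [h.apply_eq, mul_add, sum_add_distrib, sum_mul, mul_sum]
  congr 1 <;> refine sum_congr rfl fun i _ => ?_
  · rw [repr_eq]
    ring
  · rw [h.isFrame.symm (f 0 + f 1) (f i)]
    ring

theorem IsNormalForm.weight_one (h : IsNormalForm g S f ρ β) (hβ : β ≠ 0) : weight ρ 1 = 0 :=
  sub_eq_zero.2 ((extendedEigenvalue_val ρ 0).trans
    ((h.one_eq_zero hβ).symm.trans (extendedEigenvalue_val ρ 1).symm))

theorem IsNormalForm.superenergy_normalFormTerm (h : IsNormalForm g S f ρ β) (he : IsFrame g e)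
    {p : ℕ} (hp : 1 ≤ p) (hpN : p ≤ n + 2) (x y : V) :
    superenergy g e (normalFormTerm g f ρ β p) x y =
      weight ρ p * ((∑ i : Fin (n + 2), if i.val < p then sig i * (g (f i) x * g (f i) y) else 0) -
        1 / 2 * ∑ i, sig i * (g (f i) x * g (f i) y)) +
      if p = 1 then β * (g (f 0 + f 1) x * g (f 0 + f 1) y) else 0 := by
  by_cases hp1 : p = 1 ∧ β ≠ 0
  · obtain ⟨rfl, hβ⟩ := hp1
    rw [normalFormTerm_one hβ, superenergy_smul, Real.sq_sqrt h.nonneg,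
      he.superenergy_wedgeVec_null (by omega) (h.isFrame.isNull_add (i := 1) (by simp)).2,
      h.weight_one hβ, zero_mul, zero_add, if_pos rfl]
  · have no_beta : (if p = 1 then β * (g (f 0 + f 1) x * g (f 0 + f 1) y) else 0) = 0 := by
      refine ite_eq_right_iff.2 fun hp1' => ?_
      rw [not_not.1 fun hβ => hp1 ⟨hp1', hβ⟩, zero_mul]
    rw [normalFormTerm_of_le hpN hp1, superenergy_smul,
      Real.sq_sqrt (weight_nonneg h.antitone h.neg_le p),
      he.superenergy_wedgeVec_frame h.isFrame hp hpN, no_beta, add_zero,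
      ← h.isFrame.apply_eq_sum, ← sum_castLE_eq_sum_ite hpN]

theorem IsNormalForm.apply_eq_sum_superenergy (h : IsNormalForm g S f ρ β) (he : IsFrame g e)
    (x y : V) :
    S x y = ∑ p ∈ Icc 1 (n + 2), superenergy g e (normalFormTerm g f ρ β p) x y := by
  have one_mem : 1 ∈ Icc 1 (n + 2) := mem_Icc.2 ⟨le_rfl, by omega⟩
  rw [h.apply_eq_sum, sum_congr rfl fun p hp =>
    h.superenergy_normalFormTerm he (mem_Icc.1 hp).1 (mem_Icc.1 hp).2 x y, sum_add_distrib,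
    sum_weight_mul_sum_castLE, sum_ite_eq', if_pos one_mem]

end Decomposition

section Multiplicity

variable {n : ℕ} {ρ : Fin (n + 1) → ℝ}

theorem exists_forall_eq_zero_iff_lt (hρ : Antitone ρ) :
    ∃ p : Fin (n + 2), ∀ i, ρ i = ρ 0 ↔ i.castSucc < p := by
  classical
  have exists_ne : ∃ j, ∀ h : j < n + 1, ρ ⟨j, h⟩ ≠ ρ 0 :=
    ⟨n + 1, fun h => absurd h (lt_irrefl _)⟩
  have find_le : Nat.find exists_ne ≤ n + 1 :=
    Nat.find_min' exists_ne fun h => absurd h (lt_irrefl _)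
  refine ⟨⟨Nat.find exists_ne, Nat.lt_succ_of_le find_le⟩, fun i => ⟨fun hi => ?_, fun hi => ?_⟩⟩
  · by_contra hlt
    have hle : Nat.find exists_ne ≤ i.val := not_lt.1 hlt
    have hfind : Nat.find exists_ne < n + 1 := hle.trans_lt i.is_lt
    exact Nat.find_spec exists_ne hfind
      (le_antisymm (hρ (Fin.zero_le _)) (hi.ge.trans (hρ (Fin.mk_le_of_le_val hle))))
  · by_contra hne
    exact Nat.find_min exists_ne hi fun _ => hne

theorem weight_eq_zero {p : Fin (n + 2)} (hp : ∀ i, ρ i = ρ 0 ↔ i.castSucc < p) {q : ℕ}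
    (hq : q < p) : weight ρ q = 0 := by
  have eq_zero (j : ℕ) (hj : j < p) : extendedEigenvalue ρ j = ρ 0 := by
    rw [extendedEigenvalue, dif_pos (by omega)]
    exact (hp _).2 hj
  rw [weight, eq_zero q hq, eq_zero (q - 1) (by omega), sub_self]

theorem weight_pos (hρ : Antitone ρ) (hρ0 : 0 < ρ 0) {p : Fin (n + 2)}
    (hp : ∀ i, ρ i = ρ 0 ↔ i.castSucc < p) : 0 < weight ρ p := by
  have one_le : 0 < p.val := (hp 0).1 rfl
  have before : extendedEigenvalue ρ (p - 1) = ρ 0 := by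
    rw [extendedEigenvalue, dif_pos (by omega)]
    exact (hp _).2 (Fin.lt_def.2 (Nat.sub_lt one_le one_pos))
  have after : extendedEigenvalue ρ p < ρ 0 := by
    unfold extendedEigenvalue
    split_ifs with h
    · exact (hρ (Fin.zero_le _)).lt_of_ne fun heq => lt_irrefl _ ((hp _).1 heq)
    · linarith
  rw [weight, before]
  exact sub_pos.2 after

end Multiplicity

section NullEigenvectors

variable {V : Type*} [AddCommGroup V] [Module ℝ V] {n d : ℕ} {g S : LinearMap.BilinForm ℝ V}
  {f : Module.Basis (Fin (n + 2)) ℝ V} {ρ : Fin (n + 2) → ℝ} {β : ℝ} {k : Fin d → V}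

theorem IsFrame.apply_zero_ne_zero (hf : IsFrame g f) {v : V} (hv : IsNull g v) :
    g (f 0) v ≠ 0 :=
  fun h => hv.1 (hf.eq_zero_of_apply_zero hv.2.ge h)

theorem IsFrame.not_mem_flag_of_isNull (hf : IsFrame g f) {p : Fin (n + 3)} (hp : p.val < 2)
    {v : V} (hv : IsNull g v) : v ∉ f.flag p := fun hmem => by
  have flag_le : f.flag p ≤ Submodule.span ℝ {f 0} := f.flag_le_iff.2 fun i hi => by
    have hi0 : i = 0 := Fin.ext (Nat.lt_one_iff.1 (lt_of_lt_of_le hi (Nat.le_of_lt_succ hp)))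
    exact hi0 ▸ Submodule.mem_span_singleton_self _
  obtain ⟨a, rfl⟩ := Submodule.mem_span_singleton.1 (flag_le hmem)
  have hsq : a * a = 0 := by
    simpa only [map_smul, LinearMap.smul_apply, smul_eq_mul, hf.apply_zero_zero, mul_one] using hv.2
  exact hv.1 (by rw [mul_self_eq_zero.1 hsq, zero_smul])

theorem IsFrame.mem_flag (hf : IsFrame g f) {p : Fin (n + 3)} {v : V}
    (hv : ∀ i, ¬i.castSucc < p → g (f i) v = 0) : v ∈ f.flag p := by
  rw [← f.sum_repr v]
  refine sum_mem fun i _ => ?_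
  by_cases hi : i.castSucc < p
  · exact Submodule.smul_mem _ _ (f.self_mem_flag hi)
  · have hrepr : sig i * f.repr v i = 0 := by rw [← hf.apply_right, hf.symm, hv i hi]
    have hsig : sig i ≠ 0 := left_ne_zero_of_mul_eq_one (sig_mul_self i)
    rw [(mul_eq_zero.1 hrepr).resolve_left hsig, zero_smul]
    exact zero_mem _

theorem IsNormalForm.mem_flag_of_isEigenvector (h : IsNormalForm g S f ρ 0) {p : Fin (n + 3)}
    (hp : ∀ i, ρ i = ρ 0 ↔ i.castSucc < p) {v : V} (hv : IsNull g v)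
    (hve : IsEigenvector g S v) : v ∈ f.flag p := by
  obtain ⟨μ, hμ⟩ := hve.2
  have sub_mul_eq_zero (i : Fin (n + 2)) : (ρ i - μ) * g (f i) v = 0 := by
    rw [sub_mul, ← hμ, h.apply_eq]
    ring
  have hμ0 : ρ 0 = μ :=
    sub_eq_zero.1 ((mul_eq_zero.1 (sub_mul_eq_zero 0)).resolve_right
      (h.isFrame.apply_zero_ne_zero hv))
  refine h.isFrame.mem_flag fun i hi => ?_
  exact (mul_eq_zero.1 (sub_mul_eq_zero i)).resolve_left fun h0 =>
    hi ((hp i).1 ((sub_eq_zero.1 h0).trans hμ0.symm))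

theorem IsNormalForm.flag_le_span (h : IsNormalForm g S f ρ 0) (hS : S.IsSymm)
    {p : Fin (n + 3)} (hp2 : 2 ≤ p.val) (hp : ∀ i, ρ i = ρ 0 ↔ i.castSucc < p)
    (hk : IsMaxNullEigenfamily g S k) : f.flag p ≤ Submodule.span ℝ (Set.range k) := by
  have apply_f (i : Fin (n + 2)) (hi : i.castSucc < p) (x : V) : S x (f i) = ρ 0 * g x (f i) := by
    rw [hS.eq, h.apply_eq, zero_mul, add_zero, (hp i).2 hi, h.isFrame.symm]
  have zero_lt : (0 : Fin (n + 2)).castSucc < p := two_pos.trans_le hp2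
  have add_mem_span (i : Fin (n + 2)) (hi : i.castSucc < p) (hi0 : i ≠ 0) :
      f 0 + f i ∈ Submodule.span ℝ (Set.range k) :=
    hk.2.2 _ (h.isFrame.isNull_add hi0) ⟨(h.isFrame.isNull_add hi0).1, ρ 0, fun x => by
      rw [map_add, map_add, apply_f 0 zero_lt, apply_f i hi, mul_add]⟩
  have sub_mem_span (i : Fin (n + 2)) (hi : i.castSucc < p) (hi0 : i ≠ 0) :
      f 0 - f i ∈ Submodule.span ℝ (Set.range k) :=
    hk.2.2 _ (h.isFrame.isNull_sub hi0) ⟨(h.isFrame.isNull_sub hi0).1, ρ 0, fun x => by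
      rw [map_sub, map_sub, apply_f 0 zero_lt, apply_f i hi, mul_sub]⟩
  have zero_mem_span : f 0 ∈ Submodule.span ℝ (Set.range k) := by
    have one_lt : (1 : Fin (n + 2)).castSucc < p := one_lt_two.trans_le hp2
    have half : f 0 = (1 / 2 : ℝ) • (f 0 + f 1 + (f 0 - f 1)) := by module
    rw [half]
    exact Submodule.smul_mem _ _ (add_mem (add_mem_span 1 one_lt (by simp))
      (sub_mem_span 1 one_lt (by simp)))
  refine f.flag_le_iff.2 fun i hi => ?_
  rcases eq_or_ne i 0 with rfl | hi0
  · exact zero_mem_span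
  · exact (Submodule.add_mem_iff_right _ zero_mem_span).1 (add_mem_span i hi hi0)

theorem IsNormalForm.apply_add (h : IsNormalForm g S f ρ β) (hβ : β ≠ 0) (x : V) :
    S (f 0 + f 1) x = ρ 0 * g (f 0 + f 1) x := by
  have hzero : g (f 0 + f 1) (f 0) + g (f 0 + f 1) (f 1) = 0 := by
    rw [← map_add, (h.isFrame.isNull_add (i := 1) (by simp)).2]
  calc S (f 0 + f 1) x = S (f 0) x + S (f 1) x := by rw [map_add, LinearMap.add_apply]
    _ = ρ 0 * (g (f 0) x + g (f 1) x) +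
        β * g (f 0 + f 1) x * (g (f 0 + f 1) (f 0) + g (f 0 + f 1) (f 1)) := by
        rw [h.apply_eq, h.apply_eq, h.one_eq_zero hβ]
        ring
    _ = ρ 0 * g (f 0 + f 1) x := by
        rw [hzero, mul_zero, add_zero, map_add g, LinearMap.add_apply]

theorem IsNormalForm.isEigenvector_add (h : IsNormalForm g S f ρ β) (hS : S.IsSymm)
    (hβ : β ≠ 0) : IsEigenvector g S (f 0 + f 1) :=
  ⟨(h.isFrame.isNull_add (i := 1) (by simp)).1, ρ 0, fun x => by
    rw [hS.eq, h.apply_add hβ, h.isFrame.symm]⟩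

theorem IsFrame.mem_span_of_null_of_orthogonal (hf : IsFrame g f) {u v : V} (hu : IsNull g u)
    (hvv : g v v = 0) (huv : g u v = 0) : v ∈ Submodule.span ℝ {u} := by
  have hu0 := hf.apply_zero_ne_zero hu
  refine Submodule.mem_span_singleton.2 ⟨g (f 0) v / g (f 0) u, (sub_eq_zero.1 ?_).symm⟩
  apply hf.eq_zero_of_apply_zero
  · simp [hvv, huv, hu.2, hf.symm v u]
  · rw [map_sub, map_smul, smul_eq_mul, div_mul_cancel₀ _ hu0, sub_self]

theorem IsNormalForm.mem_span_of_isEigenvector (h : IsNormalForm g S f ρ β) (hβ : β ≠ 0) {v : V}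
    (hv : IsNull g v) (hve : IsEigenvector g S v) : v ∈ Submodule.span ℝ {f 0 + f 1} := by
  obtain ⟨μ, hμ⟩ := hve.2
  refine h.isFrame.mem_span_of_null_of_orthogonal (h.isFrame.isNull_add (by simp)) hv.2 ?_
  by_contra hne
  have hμ0 : ρ 0 = μ := mul_right_cancel₀ hne ((h.apply_add hβ v).symm.trans (hμ _))
  have hone : g (f 0 + f 1) (f 0) = 1 := by
    rw [map_add, LinearMap.add_apply, h.isFrame.apply_zero_zero, h.isFrame, if_neg (by simp),
      add_zero]
  have hzero : β * g (f 0 + f 1) v = 0 := by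
    have := hμ (f 0)
    rwa [h.apply_eq, hμ0, hone, one_mul, add_eq_left] at this
  exact mul_ne_zero hβ hne hzero

theorem IsNormalForm.trichotomy (h : IsNormalForm g S f ρ β) (hS : S.IsSymm)
    (hk : IsMaxNullEigenfamily g S k) :
    (d = 0 ∧ β = 0 ∧ ρ 1 < ρ 0) ∨
    (d = 1 ∧ β ≠ 0 ∧ ∀ i, ∃ a : ℝ, a ≠ 0 ∧ k i = a • (f 0 + f 1)) ∨
    (β = 0 ∧ ∃ p : Fin (n + 3), d = p ∧ 2 ≤ p.val ∧ (∀ i, ρ i = ρ 0 ↔ i.castSucc < p) ∧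
      ∀ i, k i ∈ f.flag p) := by
  rcases eq_or_ne β 0 with rfl | hβ
  · obtain ⟨p, hp⟩ := exists_forall_eq_zero_iff_lt h.antitone
    have mem_flag (i : Fin d) : k i ∈ f.flag p :=
      h.mem_flag_of_isEigenvector hp (hk.2.1 i).1 (hk.2.1 i).2
    rcases lt_or_ge p.val 2 with hp2 | hp2
    · have hd : d = 0 := Nat.eq_zero_of_not_pos fun hd =>
        h.isFrame.not_mem_flag_of_isNull hp2 (hk.2.1 ⟨0, hd⟩).1 (mem_flag _)
      refine Or.inl ⟨hd, rfl, (h.antitone (Fin.zero_le _)).lt_of_ne fun h1 => ?_⟩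
      exact hp2.not_ge ((hp 1).1 h1)
    · have span_eq : Submodule.span ℝ (Set.range k) = f.flag p :=
        le_antisymm (Submodule.span_le.2 (Set.range_subset_iff.2 mem_flag))
          (h.flag_le_span hS hp2 hp hk)
      refine Or.inr (Or.inr ⟨rfl, p, ?_, hp2, hp, mem_flag⟩)
      rw [← finrank_flag f p, ← span_eq, finrank_span_eq_card hk.1, Fintype.card_fin]
  · have hnull := h.isFrame.isNull_add (i := 1) (by simp)
    have mem_span (i : Fin d) : k i ∈ Submodule.span ℝ {f 0 + f 1} :=
      h.mem_span_of_isEigenvector hβ (hk.2.1 i).1 (hk.2.1 i).2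
    have span_eq : Submodule.span ℝ (Set.range k) = Submodule.span ℝ {f 0 + f 1} :=
      le_antisymm (Submodule.span_le.2 (Set.range_subset_iff.2 mem_span))
        ((Submodule.span_singleton_le_iff_mem _ _).2
          (hk.2.2 _ hnull (h.isEigenvector_add hS hβ)))
    refine Or.inr (Or.inl ⟨?_, hβ, fun i => ?_⟩)
    · rw [← finrank_span_singleton (K := ℝ) hnull.1, ← span_eq, finrank_span_eq_card hk.1,
        Fintype.card_fin]
    · obtain ⟨a, ha⟩ := Submodule.mem_span_singleton.1 (mem_span i)
      refine ⟨a, fun ha0 => (hk.2.1 i).1.1 ?_, ha.symm⟩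
      rw [← ha, ha0, zero_smul]

theorem IsNormalForm.exists_isAdaptedNullBasis (h : IsNormalForm g S f ρ β) (hS : S.IsSymm)
    (hk : IsMaxNullEigenfamily g S k) : ∃ m, IsAdaptedNullBasis g f k m := by
  obtain ⟨rfl, -, -⟩ | ⟨rfl, -, hka⟩ | ⟨-, p, rfl, hp2, -, hkf⟩ := h.trichotomy hS hk
  · obtain ⟨m, hm⟩ := h.isFrame.exists_isAdaptedNullBasis_pair one_ne_zero
    exact ⟨m, Subsingleton.elim _ k ▸ hm.comp_castLE le_rfl (Nat.zero_le 2)⟩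
  · obtain ⟨a, ha, hk0⟩ := hka 0
    obtain ⟨m, hm⟩ := h.isFrame.exists_isAdaptedNullBasis_pair ha
    have hprefix : ![a • (f 0 + f 1), f 0 - f 1] ∘ Fin.castLE one_le_two = k := by
      funext i
      rw [Subsingleton.elim i 0, hk0]
      rfl
    exact ⟨m, hprefix ▸ hm.comp_castLE le_rfl one_le_two⟩
  · exact h.isFrame.exists_isAdaptedNullBasis (one_le_two.trans hp2) hk.1
      (fun i => (hk.2.1 i).1) hkf

theorem IsNormalForm.normalFormTerm_eq_zero (h : IsNormalForm g S f ρ β) (hS : S.IsSymm)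
    (hk : IsMaxNullEigenfamily g S k) {p : ℕ} (hp : 1 ≤ p) (hpd : p < d) :
    normalFormTerm g f ρ β p = 0 := by
  obtain ⟨rfl, -, -⟩ | ⟨rfl, -, -⟩ | ⟨rfl, q, rfl, -, hq, -⟩ := h.trichotomy hS hk
  · omega
  · omega
  · rw [normalFormTerm_of_le (by omega) (by simp), weight_eq_zero hq hpd, Real.sqrt_zero, zero_smul]

theorem IsNormalForm.exists_normalFormTerm_eq_smul (h : IsNormalForm g S f ρ β) (hS : S.IsSymm)
    (hk : IsMaxNullEigenfamily g S k) {m : Fin (n + 2) → V} (hm : IsAdaptedNullBasis g f k m)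
    {p : ℕ} (hp : 2 ≤ p) (hpN : p ≤ n + 2) :
    ∃ c : ℝ, normalFormTerm g f ρ β p = c • wedgeVec g fun i => m (Fin.castLE hpN i) := by
  rcases lt_or_ge p d with hpd | hdp
  · exact ⟨0, by rw [h.normalFormTerm_eq_zero hS hk (by omega) hpd, zero_smul]⟩
  · rw [normalFormTerm_of_le hpN (by omega)]
    have mem_span (i : Fin p) :
        m (Fin.castLE hpN i) ∈ Submodule.span ℝ (Set.range fun i => f (Fin.castLE hpN i)) := by
      rw [span_castLE_eq_flag]
      exact hm.mem_flag _ hp hdp _ i.is_lt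
    obtain ⟨c, -, hc⟩ := exists_smul_wedgeVec_eq
      (hm.linearIndependent.comp _ (Fin.castLE_injective hpN)) mem_span √(weight ρ p)
    exact ⟨c, hc⟩

theorem IsNormalForm.zero_lt_of_ne_zero (h : IsNormalForm g S f ρ 0) (hS : S ≠ 0) : 0 < ρ 0 := by
  by_contra! hneg
  refine hS (f.ext fun i => LinearMap.ext fun x => ?_)
  have hρ : ρ i = 0 := by linarith [h.neg_le 0, h.neg_le i, h.antitone (Fin.zero_le i)]
  rw [h.apply_eq, hρ, zero_mul, zero_mul, add_zero, LinearMap.zero_apply, LinearMap.zero_apply]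

theorem IsNormalForm.exists_normalFormTerm_eq_smul_wedgeVec (h : IsNormalForm g S f ρ β)
    (hS : S.IsSymm) (hk : IsMaxNullEigenfamily g S k) (hd : 1 ≤ d) :
    ∃ c : ℝ, (S ≠ 0 → c ≠ 0) ∧ normalFormTerm g f ρ β d = c • wedgeVec g k := by
  obtain ⟨rfl, -, -⟩ | ⟨rfl, hβ, hka⟩ | ⟨rfl, p, rfl, -, hp, hkf⟩ := h.trichotomy hS hk
  · omega
  · have mem_span (i : Fin 1) :
        k i ∈ Submodule.span ℝ (Set.range fun _ : Fin 1 => f 0 + f 1) := by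
      obtain ⟨a, -, ha⟩ := hka i
      exact ha ▸ Submodule.smul_mem _ _ (Submodule.subset_span ⟨0, rfl⟩)
    obtain ⟨c, hc, hck⟩ := exists_smul_wedgeVec_eq (g := g) hk.1 mem_span √β
    refine ⟨c, fun _ => hc (Real.sqrt_pos.2 (h.nonneg.lt_of_ne hβ.symm)).ne', ?_⟩
    rw [normalFormTerm_one hβ, hck]
  · have hpN : p.val ≤ n + 2 := Nat.le_of_lt_succ p.is_lt
    have mem_span (i : Fin p) :
        k i ∈ Submodule.span ℝ (Set.range fun i => f (Fin.castLE hpN i)) := by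
      rw [span_castLE_eq_flag]
      exact hkf i
    obtain ⟨c, hc, hck⟩ := exists_smul_wedgeVec_eq (g := g) hk.1 mem_span √(weight ρ p)
    refine ⟨c, fun hS0 => hc ?_, ?_⟩
    · exact (Real.sqrt_pos.2 (weight_pos h.antitone (h.zero_lt_of_ne_zero hS0) hp)).ne'
    · rw [normalFormTerm_of_le hpN (by simp), hck]

theorem IsNormalForm.exists_isTimelike_isEigenvector (h : IsNormalForm g S f ρ β) (hS : S.IsSymm)
    (hk : IsMaxNullEigenfamily g S k) (hd : d = 0) :
    ∃ u, IsTimelike g u ∧ IsEigenvector g S u ∧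
      normalFormTerm g f ρ β 1 = wedgeVec g fun _ : Fin 1 => u := by
  obtain ⟨-, rfl, hρ⟩ | ⟨rfl, -, -⟩ | ⟨-, p, rfl, hp2, -, -⟩ := h.trichotomy hS hk
  · have hweight : 0 < weight ρ 1 := sub_pos.2
      ((extendedEigenvalue_val ρ 1).trans_lt (hρ.trans_eq (extendedEigenvalue_val ρ 0).symm))
    have hsqrt : 0 < √(weight ρ 1) := Real.sqrt_pos.2 hweight
    refine ⟨√(weight ρ 1) • f 0, ?_, ⟨smul_ne_zero hsqrt.ne' (f.ne_zero 0), ρ 0, fun x => ?_⟩, ?_⟩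
    · rw [IsTimelike, map_smul, map_smul, LinearMap.smul_apply, h.isFrame.apply_zero_zero]
      exact smul_pos hsqrt (smul_pos hsqrt one_pos)
    · rw [hS.eq, h.isFrame.symm x]
      simp only [map_smul, LinearMap.smul_apply, h.apply_eq, smul_eq_mul]
      ring
    · have hsmul := wedgeVec_smul (g := g) (fun _ : Fin 1 => √(weight ρ 1)) fun _ => f 0
      rw [Fin.prod_univ_one] at hsmul
      rw [hsmul, normalFormTerm_of_le (by omega) (by simp)]
      congr 2
      funext i
      exact congrArg f (Fin.ext (by simp))
  · omega
  · omega

end NullEigenvectors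

end Superenergy

theorem mainTheorem3 {V : Type*} [AddCommGroup V] [Module ℝ V] (N : ℕ) (hN : 2 ≤ N)
    (g : LinearMap.BilinForm ℝ V) (e : Module.Basis (Fin N) ℝ V) (he : Superenergy.IsFrame g e)
    (S : LinearMap.BilinForm ℝ V) (hsymm : ∀ x y, S x y = S y x)
    (hdom : Superenergy.Dominant g (e ⟨0, by omega⟩) S)
    (d : ℕ) (k : Fin d → V) (hk : Superenergy.IsMaxNullEigenfamily g S k) :
    ∃ (Ω : (p : ℕ) → V [⋀^Fin p]→ₗ[ℝ] ℝ) (n : Fin N → V),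
      -- the decomposition into superenergy tensors of (possibly absent) simple forms
      (∀ x y, S x y = ∑ p ∈ Finset.Icc 1 N, Superenergy.superenergy g e (Ω p) x y) ∧
      (∀ p, 1 ≤ p → p ≤ N → Ω p = 0 ∨ Superenergy.IsSimple (Ω p)) ∧
      -- for `p > 1` the form is a multiple of the product of the first `p` vectors of
      -- a null basis that begins with the null eigenvectors of `S`
      LinearIndependent ℝ n ∧ (∀ i, Superenergy.IsNull g (n i)) ∧
      (∀ (i : Fin d) (j : Fin N), i.val = j.val → n j = k i) ∧
      (∀ p, 2 ≤ p → ∀ hp : p ≤ N,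
        ∃ c : ℝ, Ω p = c • Superenergy.wedgeVec g fun i : Fin p => n (Fin.castLE hp i)) ∧
      -- there are null eigenvectors
      (∀ p, 1 ≤ p → p < d → Ω p = 0) ∧
      (1 ≤ d → ∃ c : ℝ, (S ≠ 0 → c ≠ 0) ∧ Ω d = c • Superenergy.wedgeVec g k) ∧
      -- there is no null eigenvector
      (d = 0 → ∃ u : V, Superenergy.IsTimelike g u ∧ Superenergy.IsEigenvector g S u ∧
        Ω 1 = Superenergy.wedgeVec g fun _ : Fin 1 => u) := by
  open Superenergy in
  obtain ⟨n, rfl⟩ : ∃ n, N = n + 2 := ⟨N - 2, by omega⟩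
  have hS : S.IsSymm := ⟨hsymm⟩
  obtain ⟨f, ρ, β, h⟩ := he.exists_isNormalForm hS hdom
  obtain ⟨m, hm⟩ := h.exists_isAdaptedNullBasis hS hk
  exact ⟨normalFormTerm g f ρ β, m, h.apply_eq_sum_superenergy he,
    fun p => h.isFrame.normalFormTerm_eq_zero_or_isSimple, hm.linearIndependent, hm.isNull,
    hm.apply_eq, fun p => h.exists_normalFormTerm_eq_smul hS hk hm,
    fun p => h.normalFormTerm_eq_zero hS hk, h.exists_normalFormTerm_eq_smul_wedgeVec hS hk,
    h.exists_isTimelike_isEigenvector hS hk⟩
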